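/- **Conventions.** A *graph* is a finite graph $\Gamma=(V,E)$ with loops and multiple edges allowed (each edge has an unordered pair of endpoints), considered up to isomorphism (bijections of vertices and of edges respecting endpoints). The degree of a vertex is the number of half-edges at it, so a loop counts twice. $\Gamma$ is connected if it is nonempty and any two vertices are joined by an edge path. Let $v_j(\Gamma)$ be the number of vertices of degree $j$. If all degrees lie in $\{1,\dots,N\}$, put $v_j=v_j(\Gamma)$ and take, for each $j\le N$, $v_j$ crosses with $j$ dots each. A *pairing scheme* is a partition of all the dots into pairs; its graph has the crosses as vertices and the pairs as edges, each pair joining the crosses of its two dots. $\mathrm{Aut}(\Gamma)$ is the subgroup of $\prod_{j}\mathfrak S_{v_j}\ltimes(\mathfrak S_j)^{v_j}$ (permuting crosses with equally many dots, and the dots within each cross) that stabilizes a pairing scheme whose graph is $\Gamma$; up to conjugation it does not depend on the scheme. For $0<\epsilon<\pi/2$ let $\Omega_\epsilon=\{z\in\mathbb C\setminus\{0\}: \pi/2+\epsilon<\arg z<3\pi/2-\epsilon\}$. A formal series $\sum_k a_kz^k$ is the asymptotic expansion at $0$ of a holomorphic function $h$ on $\Omega_\epsilon$ if $\lim_{z\to0,\,z\in\Omega_\epsilon}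 z^{-(M+1)}\bigl(h(z)-\sum_{k=0}^{M}a_kz^k\bigr)=a_{M+1}$ for all $M\ge0$. For a holomorphic function $F(t_1,\dots,t_{2m})$ on $\mathbb C^{2m-1}\times\Omega_\epsilon$, $\mathcal A(F)$ denotes the formal power series in $t_1,\dots,t_{2m}$ obtained by expanding $F$ as an everywhere convergent Taylor series at the origin in $(t_1,\dots,t_{2m-1})\in\mathbb C^{2m-1}$, with coefficients holomorphic in $t_{2m}\in\Omega_\epsilon$, and replacing each coefficient by its asymptotic expansion at $t_{2m}=0$ on $\Omega_\epsilon$. **Theorem 1.6.** Let $m\ge2$ and $$Z(t_1,\dots,t_{2m})=\int_{-\infty}^{\infty}e^{-x^2/2}\exp\Bigl(\sum_{j=1}^{2m}\frac{t_j}{j!}x^j\Bigr)\frac{dx}{\sqrt{2\pi}} .$$ For every $0<\epsilon<\pi/2$, the integral converges absolutely and defines a holomorphic function on $\mathbb C^{2m-1}\times\Omega_\epsilon$. Its expansion $\mathcal A(Z)$ exists, is unique, does not depend on $\epsilon$, has rational coefficients and constant term $1$, and $$\mathcal A(Z)=\sum_{\Gamma}\frac{1}{|\mathrm{Aut}(\Gamma)|}\prod_{j=1}^{2m}t_j^{v_j(\Gamma)}\in\mathbb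 Q[[t_1,\dots,t_{2m}]],$$ the sum being over all graphs (including the empty one) whose vertex degrees all lie in $\{1,\dots,2m\}$. Its formal logarithm, defined by $\log(1-z)=-\sum_{n\ge1}z^n/n$, is $$\log\mathcal A(Z)=\sum_{\Gamma\ \text{connected}}\frac{1}{|\mathrm{Aut}(\Gamma)|}\prod_{j=1}^{2m}t_j^{v_j(\Gamma)},$$ the sum being over connected graphs whose vertex degrees all lie in $\{1,\dots,2m\}$. In both sums only finitely many graphs contribute to each coefficient. -/

import Mathlib

open MeasureTheory Filter Topology

noncomputable section

namespace FeynmanExpansion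

/-! ### Graphs -/

/-- A finite graph `(V, E, i)` in the sense of one-dimensional finite CW complexes: a finite set of
vertices, a finite set of edges, and for every edge the unordered pair of its endpoints.
Loops and multiple edges are allowed. -/
structure MultiGraph where
  V : Type
  E : Type
  finiteV : Finite V
  finiteE : Finite E
  ends : E → Sym2 V

attribute [instance] MultiGraph.finiteV MultiGraph.finiteE

namespace MultiGraph

/-- The degree of a vertex: the number of half-edges coming out of it. Every edge at `x`
contributes one half-edge, and every loop at `x` contributes a second one. -/
def degree (Γ : MultiGraph) (x : Γ.V) : ℕ :=
  Nat.card {e : Γ.E // x ∈ Γ.ends e} + Nat.card {e : Γ.E // Γ.ends e = s(x, x)}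

/-- All vertices have degree in `{1, …, N}`. -/
def DegreesIn (Γ : MultiGraph) (N : ℕ) : Prop :=
  ∀ x : Γ.V, 1 ≤ Γ.degree x ∧ Γ.degree x ≤ N

/-- `Γ.vertexCount N j` is the number of vertices of degree `j + 1`, for `j = 0, …, N - 1`. -/
def vertexCount (Γ : MultiGraph) (N : ℕ) (j : Fin N) : ℕ :=
  Nat.card {x : Γ.V // Γ.degree x = (j : ℕ) + 1}

/-- A graph is connected if it is nonempty and any two vertices are joined by an edge path. -/
def Connected (Γ : MultiGraph) : Prop :=
  Nonempty Γ.V ∧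
    ∀ x y : Γ.V, Relation.ReflTransGen (fun a b => ∃ e : Γ.E, Γ.ends e = s(a, b)) x y

/-- Isomorphism of graphs: bijections on vertices and on edges that respect endpoints. -/
def Isomorphic (Γ Δ : MultiGraph) : Prop :=
  ∃ (φ : Γ.V ≃ Δ.V) (ψ : Γ.E ≃ Δ.E), ∀ e, Δ.ends (ψ e) = (Γ.ends e).map φ

instance isoSetoid : Setoid MultiGraph where
  r := Isomorphic
  iseqv :=
    { refl := fun Γ => ⟨Equiv.refl _, Equiv.refl _, fun e => by simp⟩
      symm := by
        rintro Γ Δ ⟨φ, ψ, h⟩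
        refine ⟨φ.symm, ψ.symm, fun e => ?_⟩
        have h1 := h (ψ.symm e)
        rw [Equiv.apply_symm_apply] at h1
        rw [h1, Sym2.map_map]
        simp
      trans := by
        rintro Γ Δ Λ ⟨φ, ψ, h⟩ ⟨φ', ψ', h'⟩
        refine ⟨φ.trans φ', ψ.trans ψ', fun e => ?_⟩
        rw [Equiv.trans_apply, h', h, Sym2.map_map]
        rfl }

end MultiGraph

/-- Isomorphism classes of graphs. -/
abbrev GraphClass := Quotient MultiGraph.isoSetoid

/-- A graph in a given isomorphism class. -/
def GraphClass.rep (q : GraphClass) : MultiGraph := Quotient.out q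

/-! ### Pairing schemes and automorphism groups -/

/-- The crosses of a dot diagram of type `v`: `v j` crosses with `j + 1` legs, for every `j`. -/
abbrev Cross {N : ℕ} (v : Fin N → ℕ) : Type := Σ j : Fin N, Fin (v j)

/-- The dots of a dot diagram of type `v`: the endpoints of the legs of all the crosses. -/
abbrev Dot {N : ℕ} (v : Fin N → ℕ) : Type := Σ c : Cross v, Fin ((c.1 : ℕ) + 1)

/-- A pairing scheme: a partition of the dots into pairs, given by the map that sends each dot
to its partner, which is an involution without fixed points. -/
structure PairingScheme {N : ℕ} (v : Fin N → ℕ) where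
  partner : Dot v → Dot v
  partner_partner : ∀ d, partner (partner d) = d
  partner_ne : ∀ d, partner d ≠ d

/-- The image in the permutations of the dots of the (faithfully acting) group
`∏ⱼ 𝔖_{v j} ⋉ (𝔖_{j+1})^{v j}`, which permutes the crosses with equally many legs and permutes the
legs of each single cross. -/
def dotSymmetry {N : ℕ} (v : Fin N → ℕ) : Subgroup (Equiv.Perm (Dot v)) where
  carrier := {g | ∃ (π : ∀ j : Fin N, Equiv.Perm (Fin (v j)))
    (ρ : ∀ c : Cross v, Equiv.Perm (Fin ((c.1 : ℕ) + 1))),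
    ∀ (c : Cross v) (k : Fin ((c.1 : ℕ) + 1)), g ⟨c, k⟩ = ⟨⟨c.1, π c.1 c.2⟩, ρ c k⟩}
  mul_mem' := by
    rintro g g' ⟨π, ρ, h⟩ ⟨π', ρ', h'⟩
    refine ⟨fun j => π j * π' j, fun c => ρ ⟨c.1, π' c.1 c.2⟩ * ρ' c, fun c k => ?_⟩
    rw [Equiv.Perm.mul_apply, h', h]
    rfl
  one_mem' := ⟨fun _ => 1, fun _ => 1, fun _ _ => rfl⟩
  inv_mem' := by
    rintro g ⟨π, ρ, h⟩
    refine ⟨fun j => (π j)⁻¹, fun c => (ρ ⟨c.1, (π c.1)⁻¹ c.2⟩)⁻¹, ?_⟩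
    rintro ⟨j, i⟩ k
    rw [Equiv.Perm.inv_eq_iff_eq, h]
    simp

namespace PairingScheme

variable {N : ℕ} {v : Fin N → ℕ}

/-- The isotropy subgroup of a pairing scheme: the elements of the group
`∏ⱼ 𝔖_{v j} ⋉ (𝔖_{j+1})^{v j}` that preserve the pairing. -/
def isotropy (P : PairingScheme v) : Subgroup (Equiv.Perm (Dot v)) where
  carrier := {g | g ∈ dotSymmetry v ∧ ∀ d, P.partner (g d) = g (P.partner d)}
  mul_mem' := by
    rintro g g' ⟨h, hP⟩ ⟨h', hP'⟩
    exact ⟨mul_mem h h', fun d => by simp [hP, hP']⟩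
  one_mem' := ⟨one_mem _, fun _ => rfl⟩
  inv_mem' := by
    rintro g ⟨h, hP⟩
    exact ⟨inv_mem h, fun d => by rw [Equiv.Perm.eq_inv_iff_eq, ← hP]; simp⟩

/-- The Feynman diagram of a pairing scheme: its vertices are the crosses, its edges are the pairs
of dots, and a pair of dots joins the crosses to which the two dots belong. -/
def graph (P : PairingScheme v) : MultiGraph where
  V := Cross v
  E := {p : Sym2 (Dot v) // ∃ d, p = s(d, P.partner d)}
  finiteV := inferInstance
  finiteE := inferInstance
  ends := fun p => p.1.map Sigma.fst

end PairingScheme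

/-- Every graph with vertex degrees in `{1, …, N}` comes from a pairing scheme. -/
theorem exists_pairingScheme (Γ : MultiGraph) {N : ℕ} (hΓ : Γ.DegreesIn N) :
    ∃ P : PairingScheme (Γ.vertexCount N), P.graph.Isomorphic Γ := by
  classical
  have hends : ∀ e, ∃ a : Γ.V × Γ.V, Γ.ends e = s(a.1, a.2) := fun e =>
    ⟨(Γ.ends e).out, (Quot.out_eq (Γ.ends e)).symm⟩
  choose a ha using hends
  -- vertices and crosses
  let f : Γ.V → Fin N := fun x => ⟨Γ.degree x - 1, by have := hΓ x; omega⟩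
  have hf : ∀ x, ((f x : Fin N) : ℕ) + 1 = Γ.degree x := fun x => by
    have := hΓ x
    simp only [f]; omega
  let e1 : ∀ j : Fin N, {x : Γ.V // f x = j} ≃ Fin (Γ.vertexCount N j) := fun j =>
    (Equiv.subtypeEquivRight (fun x => by
      have := hf x
      rw [Fin.ext_iff]; omega)).trans (Finite.equivFin {x : Γ.V // Γ.degree x = (j : ℕ) + 1})
  let φ : Γ.V ≃ Cross (Γ.vertexCount N) :=
    (Equiv.sigmaFiberEquiv f).symm.trans (Equiv.sigmaCongrRight e1)
  have hφ : ∀ x, (φ x).1 = f x := fun x => rfl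
  -- half-edges and dots
  let w : Γ.E × Bool → Γ.V := fun h => if h.2 then (a h.1).2 else (a h.1).1
  have hcard : ∀ x, Nat.card {h : Γ.E × Bool // w h = x} = Γ.degree x := by
    intro x
    have E1 : {h : Γ.E × Bool // w h = x} ≃
        {e : Γ.E // (a e).1 = x} ⊕ {e : Γ.E // (a e).2 = x} :=
      { toFun := fun h => match h with
          | ⟨(e, false), p⟩ => Sum.inl ⟨e, by simpa [w] using p⟩
          | ⟨(e, true), p⟩ => Sum.inr ⟨e, by simpa [w] using p⟩
        invFun := fun s => match s with
          | Sum.inl e => ⟨(e.1, false), by simpa [w] using e.2⟩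
          | Sum.inr e => ⟨(e.1, true), by simpa [w] using e.2⟩
        left_inv := by rintro ⟨⟨e, _ | _⟩, p⟩ <;> rfl
        right_inv := by rintro (e | e) <;> rfl }
    rw [Nat.card_congr E1, Nat.card_sum, MultiGraph.degree]
    have c : ∀ p : Γ.E → Prop, Nat.card {e // p e} = {e | p e}.ncard := fun p =>
      Nat.card_coe_set_eq {e | p e}
    rw [c, c, c, c, ← Set.ncard_union_add_ncard_inter]
    congr 2
    · ext e
      simp [ha, Sym2.mem_iff, eq_comm]
    · ext e
      simp [ha, Prod.ext_iff]
  let e2 : ∀ x, {h : Γ.E × Bool // w h = x} ≃ Fin (((φ x).1 : ℕ) + 1) := fun x =>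
    (Finite.equivFin _).trans (finCongr (by rw [hcard, hφ, hf]))
  let θ : Γ.E × Bool ≃ Dot (Γ.vertexCount N) :=
    (Equiv.sigmaFiberEquiv w).symm.trans (Equiv.sigmaCongr φ e2)
  have hθ : ∀ h, (θ h).1 = φ (w h) := fun h => rfl
  let P : PairingScheme (Γ.vertexCount N) :=
    { partner := fun d => θ ((θ.symm d).1, !(θ.symm d).2)
      partner_partner := fun d => by simp
      partner_ne := fun d hd => by
        have := congrArg (fun z => (θ.symm z).2) hd
        simp at this }
  have hP : ∀ e b, P.partner (θ (e, b)) = θ (e, !b) := fun e b => by simp [P]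
  let g : Γ.E → P.graph.E := fun e => ⟨s(θ (e, false), θ (e, true)), θ (e, false), by rw [hP]; rfl⟩
  have hg : Function.Bijective g := by
    constructor
    · intro e e' h
      have h1 := congrArg Subtype.val h
      simp only [g, Sym2.eq_iff, EmbeddingLike.apply_eq_iff_eq, Prod.mk.injEq] at h1
      tauto
    · rintro ⟨p, d, rfl⟩
      obtain ⟨⟨e, b⟩, rfl⟩ := θ.surjective d
      refine ⟨e, Subtype.ext ?_⟩
      change s(θ (e, false), θ (e, true)) = s(θ (e, b), P.partner (θ (e, b)))
      rw [hP]
      cases b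
      · rfl
      · exact Sym2.eq_swap
  refine ⟨P, MultiGraph.isoSetoid.symm (a := Γ) (b := P.graph) ⟨φ, Equiv.ofBijective g hg, ?_⟩⟩
  intro e
  change Sym2.map Sigma.fst s(θ (e, false), θ (e, true)) = _
  rw [ha, Sym2.map_mk, Sym2.map_mk]
  simp only [hθ, w]
  rfl

/-- A pairing scheme whose Feynman diagram is `Γ`. -/
def MultiGraph.pairingScheme (Γ : MultiGraph) {N : ℕ} (hΓ : Γ.DegreesIn N) :
    PairingScheme (Γ.vertexCount N) :=
  Classical.choose (exists_pairingScheme Γ hΓ)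

/-- The automorphism group of a graph with vertex degrees in `{1, …, N}`: the isotropy
subgroup of a pairing scheme corresponding to the graph. (Another choice of the pairing scheme
gives a conjugate subgroup.) -/
def MultiGraph.autGroup (Γ : MultiGraph) {N : ℕ} (hΓ : Γ.DegreesIn N) :
    Subgroup (Equiv.Perm (Dot (Γ.vertexCount N))) :=
  (Γ.pairingScheme hΓ).isotropy

/-! ### Formal power series -/

/-- The family `f` of formal power series is summable coefficient by coefficient (only finitely
many members contribute to each coefficient), with sum `F`. -/
def HasFormalSum {ι : Type*} {σ : Type*} (f : ι → MvPowerSeries σ ℚ) (F : MvPowerSeries σ ℚ) :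
    Prop :=
  ∀ n : σ →₀ ℕ, {i | MvPowerSeries.coeff n (f i) ≠ 0}.Finite ∧
    MvPowerSeries.coeff n F = ∑ᶠ i, MvPowerSeries.coeff n (f i)

/-- The formal logarithm of a power series with constant coefficient `1`: the power series
`log (1 + X) = X - X² / 2 + X³ / 3 - ⋯` evaluated at `A - 1`. -/
def formalLog {σ : Type*} (A : MvPowerSeries σ ℚ) : MvPowerSeries σ ℚ :=
  (PowerSeries.log ℚ).subst (A - 1)

/-- The contribution `(1 / |Aut Γ|) ∏ⱼ tⱼ ^ vⱼ(Γ)` of a graph `Γ`, where `vⱼ(Γ)` is the number of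
vertices of degree `j`. The variable `tⱼ` has the index `j - 1` in `Fin N`. -/
def graphTerm (Γ : MultiGraph) {N : ℕ} (hΓ : Γ.DegreesIn N) : MvPowerSeries (Fin N) ℚ :=
  MvPowerSeries.monomial (Finsupp.equivFunOnFinite.symm (Γ.vertexCount N))
    (1 / (Nat.card (Γ.autGroup hΓ) : ℚ))

/-! ### The integral and its asymptotic expansion -/

/-- The sector `{z | π / 2 + ε < arg z < 3 π / 2 - ε}`, with vertex `0` excluded. -/
def sector (ε : ℝ) : Set ℂ :=
  {z | ∃ r θ : ℝ, 0 < r ∧ Real.pi / 2 + ε < θ ∧ θ < 3 * Real.pi / 2 - ε ∧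
    z = (r : ℂ) * Complex.exp ((θ : ℂ) * Complex.I)}

/-- The integrand `e^{-x²/2} exp (∑ⱼ tⱼ x^j / j!) / √(2π)`, with `1 ≤ j ≤ N`. -/
def integrand {N : ℕ} (t : Fin N → ℂ) (x : ℝ) : ℂ :=
  Complex.exp (-(x : ℂ) ^ 2 / 2) *
    Complex.exp (∑ j : Fin N, t j / (Nat.factorial ((j : ℕ) + 1) : ℂ) * (x : ℂ) ^ ((j : ℕ) + 1)) /
    (Real.sqrt (2 * Real.pi) : ℂ)

/-- The integral `Z(t₁, …, t_N)`. -/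
def partitionFunction {N : ℕ} (t : Fin N → ℂ) : ℂ := ∫ x : ℝ, integrand t x

/-- The formal power series `∑ aₖ zᵏ` is an asymptotic expansion at `0` of the holomorphic
function `h` on `Ω`. -/
def IsAsymptoticExpansion (Ω : Set ℂ) (h : ℂ → ℂ) (a : PowerSeries ℂ) : Prop :=
  DifferentiableOn ℂ h Ω ∧
    ∀ M : ℕ, Tendsto
      (fun z => (h z - ∑ k ∈ Finset.range (M + 1), PowerSeries.coeff k a * z ^ k) / z ^ (M + 1))
      (𝓝[Ω] 0) (𝓝 (PowerSeries.coeff (M + 1) a))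

/-- `A` is the expansion of the holomorphic function `F`, defined where the coordinate `t ℓ` lies
in `Ω`, as a Taylor series at the origin in the variables other than `t ℓ` and as an asymptotic
series in `t ℓ ∈ Ω` at `0`: for each `z ∈ Ω` the Taylor series of `F` with `t ℓ = z` fixed, with
coefficients `c w z`, converges to `F` for all values of the other variables, and the coefficient of
`A` at the monomial `t^w * (t ℓ)^k` is the `k`-th coefficient of the asymptotic
expansion of `c w` on `Ω`. Here `w` runs over the multi-indices that do not involve `ℓ`. -/
def IsMixedExpansion {σ : Type*} [Fintype σ] (ℓ : σ) (Ω : Set ℂ) (F : (σ → ℂ) → ℂ)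
    (A : MvPowerSeries σ ℂ) : Prop :=
  DifferentiableOn ℂ F {t | t ℓ ∈ Ω} ∧
    ∃ c : {w : σ →₀ ℕ // w ℓ = 0} → ℂ → ℂ,
      (∀ t : σ → ℂ, t ℓ ∈ Ω →
        HasSum (fun w : {w : σ →₀ ℕ // w ℓ = 0} => c w (t ℓ) * ∏ j, t j ^ w.1 j) (F t)) ∧
      ∀ w : {w : σ →₀ ℕ // w ℓ = 0},
        IsAsymptoticExpansion Ω (c w)
          (PowerSeries.mk fun k => MvPowerSeries.coeff (w.1 + Finsupp.single ℓ k) A)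

end FeynmanExpansion

end

noncomputable section

namespace FeynmanExpansion

/-! ### Pairings of a type -/

/-! Everything passes through one rational series, `pairingSeries`: its coefficient at `v` is the
number of pairings of the dots of a diagram of type `v`, divided by the order of the symmetry group
of that diagram. This series is matched with the graphs, with its logarithm and with the integral.

Graphs. The symmetry group acts on the pairing schemes of type `v` by conjugation. Two schemes have
isomorphic graphs exactly when they lie in one orbit (`graph_isomorphic_iff`), and the isotropy
group is the automorphism group, so orbit-stabilizer turns the number of schemes over the group
order into a sum of `1 / |Aut Γ|` (`hasFormalSum_graphTerm`). Restricted to connected schemes, the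
same count gives `connSeries`.

Logarithm. Mark a cross of a pairing scheme and split off the component that contains it
(`card_mul_card_pairing`). After division by the group orders this reads `E A = A * E C`, where `E`
multiplies each monomial by its degree, `A` is the series of all schemes and `C` that of the
connected ones. With constant terms `1` and `0` this forces `log A = C` (`formalLog_eq_of_eulerOp`).

Analysis. When the top coefficient has negative real part, the even top power dominates the exponent
and the exponential is bounded, uniformly enough for dominated convergence (`exists_exponent_le`).
Expanding in the other variables under the integral leaves coefficients of the form `∫ g exp (z y)`
with `y ≥ 0`. On `Re u ≤ 0` the Taylor remainder of `exp u` is at most a constant times `‖u‖ ^ n`,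
so these have asymptotic expansions whose coefficients are Gaussian moments, and integration by
parts shows that the moments obey the recursion of the pairing numbers. Uniqueness combines that of
convergent power series with that of asymptotic expansions. -/

/-- A partition of a type into pairs, given as a fixed-point-free involution. -/
@[ext]
structure Pairing (X : Type*) where
  partner : X → X
  partner_partner : ∀ d, partner (partner d) = d
  partner_ne : ∀ d, partner d ≠ d

namespace Pairing

variable {X Y : Type*}

instance [Finite X] : Finite (Pairing X) :=
  Finite.of_injective Pairing.partner fun _ _ h => Pairing.ext h

/-- Transport of pairings along a bijection. -/
def congr (e : X ≃ Y) : Pairing X ≃ Pairing Y where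
  toFun P := ⟨fun y => e (P.partner (e.symm y)), fun y => by simp [P.partner_partner],
    fun y h => P.partner_ne (e.symm y) (e.injective (by rw [h]; simp))⟩
  invFun P := ⟨fun y => e.symm (P.partner (e y)), fun y => by simp [P.partner_partner],
    fun y h => P.partner_ne (e y) (e.symm.injective (by rw [h]; simp))⟩
  left_inv P := by ext; simp
  right_inv P := by ext; simp

/-- The restriction of a pairing to a closed part. -/
def restrict (P : Pairing X) (T : X → Prop) (h : ∀ d, T d → T (P.partner d)) :
    Pairing {d // T d} :=
  ⟨fun d => ⟨P.partner d, h d d.2⟩, fun d => by simp [P.partner_partner],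
    fun d hd => P.partner_ne d (congrArg Subtype.val hd)⟩

theorem partner_eq_symm (P : Pairing X) {x y : X} (h : P.partner x = y) : P.partner y = x := by
  rw [← h, P.partner_partner]

theorem closed_not (P : Pairing X) {T : X → Prop} (h : ∀ d, T d → T (P.partner d)) :
    ∀ d, ¬ T d → ¬ T (P.partner d) := fun d hd hd' =>
  hd (by simpa [P.partner_partner] using h _ hd')

open Classical in
/-- The union of a pairing of a part and a pairing of its complement. -/
def glue {T : X → Prop} (P : Pairing {d // T d}) (Q : Pairing {d // ¬ T d}) : Pairing X where
  partner d := if h : T d then P.partner ⟨d, h⟩ else Q.partner ⟨d, h⟩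
  partner_partner d := by
    by_cases h : T d
    · simp [h, (P.partner ⟨d, h⟩).2, P.partner_partner]
    · simp [h, (Q.partner ⟨d, h⟩).2, Q.partner_partner]
  partner_ne d hd := by
    by_cases h : T d
    · exact P.partner_ne ⟨d, h⟩ (Subtype.ext (by simpa [h] using hd))
    · exact Q.partner_ne ⟨d, h⟩ (Subtype.ext (by simpa [h] using hd))

theorem glue_pos {T : X → Prop} (P : Pairing {d // T d}) (Q : Pairing {d // ¬ T d}) {d : X}
    (h : T d) : (glue P Q).partner d = P.partner ⟨d, h⟩ := by simp [glue, h]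

theorem glue_neg {T : X → Prop} (P : Pairing {d // T d}) (Q : Pairing {d // ¬ T d}) {d : X}
    (h : ¬ T d) : (glue P Q).partner d = Q.partner ⟨d, h⟩ := by simp [glue, h]

theorem glue_closed {T : X → Prop} (P : Pairing {d // T d}) (Q : Pairing {d // ¬ T d}) :
    ∀ d, T d → T ((glue P Q).partner d) := fun d h => by
  rw [glue_pos P Q h]; exact (P.partner ⟨d, h⟩).2

theorem restrict_glue {T : X → Prop} (P : Pairing {d // T d}) (Q : Pairing {d // ¬ T d}) :
    (glue P Q).restrict T (glue_closed P Q) = P := by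
  ext d
  change (glue P Q).partner d = _
  rw [glue_pos P Q d.2]

/-- Pairings with a closed part satisfying some property are pairs consisting of a pairing of that
part with this property and a pairing of the complement. -/
def splitEquiv (T : X → Prop) (K : Pairing {d // T d} → Prop) :
    {P : Pairing X // ∃ h : ∀ d, T d → T (P.partner d), K (P.restrict T h)} ≃
      {P : Pairing {d // T d} // K P} × Pairing {d // ¬ T d} where
  toFun P := (⟨P.1.restrict T P.2.1, P.2.2⟩,
    P.1.restrict (fun d => ¬ T d) (P.1.closed_not P.2.1))
  invFun R := ⟨glue R.1.1 R.2, glue_closed _ _, by rw [restrict_glue]; exact R.1.2⟩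
  left_inv P := by
    refine Subtype.ext (Pairing.ext (funext fun d => ?_))
    by_cases h : T d
    · simp only [glue_pos _ _ h]; rfl
    · simp only [glue_neg _ _ h]; rfl
  right_inv R := by
    refine Prod.ext (Subtype.ext (restrict_glue _ _)) (Pairing.ext (funext fun d => Subtype.ext ?_))
    change (glue R.1.1 R.2).partner d = _
    rw [glue_neg _ _ d.2]

/-- Pairings that match two given elements are pairings of the remaining elements. -/
def matchEquiv {x y : X} (hxy : y ≠ x) :
    {P : Pairing X // P.partner x = y} ≃ Pairing {z // z ≠ x ∧ z ≠ y} := by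
  classical
  exact
  { toFun := fun P => P.1.restrict _ fun z hz => by
      exact ⟨fun h => hz.2 ((P.1.partner_eq_symm h).symm.trans P.2),
        fun h => hz.1 ((P.1.partner_eq_symm h).symm.trans (P.1.partner_eq_symm P.2))⟩
    invFun := fun Q => ⟨
      { partner := fun z => if h : z ≠ x ∧ z ≠ y then Q.partner ⟨z, h⟩ else
          if z = x then y else x
        partner_partner := fun z => by
          by_cases h : z ≠ x ∧ z ≠ y
          · simp [h, (Q.partner ⟨z, h⟩).2, Q.partner_partner]
          · by_cases h' : z = x
            · simp [h', hxy]
            · have : z = y := by tauto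
              simp [this, hxy]
        partner_ne := fun z hz => by
          by_cases h : z ≠ x ∧ z ≠ y
          · exact Q.partner_ne ⟨z, h⟩ (Subtype.ext (by simpa [h] using hz))
          · by_cases h' : z = x
            · simp [h', hxy] at hz
            · have : z = y := by tauto
              simp [this, hxy, hxy.symm] at hz }, by simp⟩
    left_inv := fun P => by
      have hy := P.1.partner_eq_symm P.2
      refine Subtype.ext (Pairing.ext (funext fun z => ?_))
      by_cases h : z ≠ x ∧ z ≠ y
      · simp [h, restrict]
      · by_cases h' : z = x
        · simp [h', P.2]
        · have : z = y := by tauto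
          simp [this, hxy, hy]
    right_inv := fun Q => by
      refine Pairing.ext (funext fun z => Subtype.ext ?_)
      simp [restrict, z.2] }

end Pairing

/-- The number of pairings of a set with `n` elements. -/
def pairingNumber : ℕ → ℕ
  | 0 => 1
  | 1 => 0
  | k + 2 => (k + 1) * pairingNumber k

/-- Among `k + 2` elements a fixed element `x` has `k + 1` possible partners, and deleting the pair
of `x` leaves a pairing of `k` elements. -/
theorem card_pairing : ∀ (n : ℕ) (X : Type) [Finite X], Nat.card X = n →
    Nat.card (Pairing X) = pairingNumber n
  | 0, X, _, h => by
    have : IsEmpty X := (Nat.card_eq_zero.1 h).resolve_right (by simpa using ‹Finite X›)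
    rw [pairingNumber, Nat.card_eq_one_iff_unique]
    exact ⟨⟨fun P Q => Pairing.ext (funext fun d => isEmptyElim d)⟩,
      ⟨⟨isEmptyElim, isEmptyElim, isEmptyElim⟩⟩⟩
  | 1, X, _, h => by
    have := (Nat.card_eq_one_iff_unique.1 h).1
    obtain ⟨x⟩ := (Nat.card_eq_one_iff_unique.1 h).2
    rw [pairingNumber, Nat.card_eq_zero]
    exact Or.inl ⟨fun P => P.partner_ne x (Subsingleton.elim _ _)⟩
  | k + 2, X, _, h => by
    classical
    have : Fintype X := Fintype.ofFinite X
    have hne : Nonempty X := (Nat.card_pos_iff.1 (by omega)).1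
    obtain ⟨x⟩ := hne
    have e : Pairing X ≃ Σ y : {y // y ≠ x}, {P : Pairing X // P.partner x = y} :=
      { toFun := fun P => ⟨⟨P.partner x, P.partner_ne x⟩, P, rfl⟩
        invFun := fun R => R.2.1
        left_inv := fun _ => rfl
        right_inv := by
          rintro ⟨⟨y, hy⟩, P, h⟩
          have h' : P.partner x = y := h
          subst h'
          rfl }
    have h1 : ∀ y : {y // y ≠ x}, Nat.card {P : Pairing X // P.partner x = y} =
        pairingNumber k := fun y => by
      rw [Nat.card_congr (Pairing.matchEquiv y.2)]
      apply card_pairing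
      rw [Nat.card_eq_fintype_card, Fintype.card_subtype]
      have : (Finset.univ.filter fun z => z ≠ x ∧ z ≠ (y : X)) =
          (Finset.univ.erase x).erase y := by ext; simp [and_comm]
      rw [this, Finset.card_erase_of_mem (by simp [y.2]), Finset.card_erase_of_mem (by simp),
        Finset.card_univ, ← Nat.card_eq_fintype_card, h]
      omega
    rw [Nat.card_congr e, Nat.card_sigma, Finset.sum_congr rfl fun y _ => h1 y,
      Finset.sum_const, pairingNumber, smul_eq_mul]
    congr 1
    rw [Finset.card_univ, Fintype.card_subtype_compl, Fintype.card_subtype_eq,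
      ← Nat.card_eq_fintype_card, h]
    rfl

/-! ### Connected pairings -/

/-- Two classes of the fibration `π` are adjacent if some pair joins them. -/
def Pairing.Joined {X κ : Type*} (π : X → κ) (P : Pairing X) (a b : κ) : Prop :=
  ∃ d, π d = a ∧ π (P.partner d) = b

/-- A pairing of the total space of `π` is connected if it joins any two points of the base
by a path. -/
def Pairing.Conn {X κ : Type*} (π : X → κ) (P : Pairing X) : Prop :=
  Nonempty κ ∧ ∀ a b : κ, Relation.ReflTransGen (P.Joined π) a b

/-- The number of connected pairings. -/
def connCount {X κ : Type*} (π : X → κ) : ℕ := Nat.card {P : Pairing X // P.Conn π}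

theorem Pairing.Joined.symm {X κ : Type*} {π : X → κ} {P : Pairing X} {a b : κ}
    (h : P.Joined π a b) : P.Joined π b a := by
  obtain ⟨d, h1, h2⟩ := h
  exact ⟨P.partner d, h2, by rw [P.partner_partner, h1]⟩

/-- Connectedness only sees the map from dots to crosses up to relabelling. This allows a component,
which is a subset of the crosses, to be replaced by the standard diagram of its type. -/
theorem connCount_congr {X κ X' κ' : Type*} {π : X → κ} {π' : X' → κ'} (e : X ≃ X') (φ : κ ≃ κ')
    (h : ∀ d, π' (e d) = φ (π d)) : connCount π = connCount π' := by
  refine Nat.card_congr ((Pairing.congr e).subtypeEquiv fun P => ?_)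
  have key : ∀ a b, P.Joined π a b ↔ (Pairing.congr e P).Joined π' (φ a) (φ b) := by
    intro a b
    constructor
    · rintro ⟨d, rfl, rfl⟩
      exact ⟨e d, h d, by simp [Pairing.congr, h]⟩
    · rintro ⟨d, h1, h2⟩
      obtain ⟨d, rfl⟩ := e.surjective d
      refine ⟨d, φ.injective (by rw [← h, h1]),
        φ.injective (by rw [← h2, ← h]; simp [Pairing.congr])⟩
  constructor
  · rintro ⟨⟨a⟩, hc⟩
    refine ⟨⟨φ a⟩, fun x y => ?_⟩
    have := Relation.ReflTransGen.lift φ (fun a b hab => (key a b).1 hab) _ _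
      (hc (φ.symm x) (φ.symm y))
    simpa [Function.onFun] using this
  · rintro ⟨⟨a⟩, hc⟩
    refine ⟨⟨φ.symm a⟩, fun x y => ?_⟩
    have := Relation.ReflTransGen.lift φ.symm (p := P.Joined π)
      (fun a b hab => (key _ _).2 (by simpa using hab)) _ _ (hc (φ x) (φ y))
    simpa [Function.onFun] using this

section Components

variable {X κ : Type} (π : X → κ)

/-- `S` is the vertex set of a connected component of the pairing `P`. -/
def IsComponent (S : Set κ) (P : Pairing X) : Prop :=
  ∃ h : ∀ d, π d ∈ S → π (P.partner d) ∈ S,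
    (P.restrict (fun d => π d ∈ S) h).Conn fun d => (⟨π d.1, d.2⟩ : S)

variable {π}

/-- A path that starts in a set closed under the pairing never leaves it, so it is also a path of
the restricted pairing. -/
theorem reflTransGen_restrict {S : Set κ} {P : Pairing X}
    (h : ∀ d, π d ∈ S → π (P.partner d) ∈ S) {a b : κ} (ha : a ∈ S)
    (hab : Relation.ReflTransGen (P.Joined π) a b) :
    ∃ hb : b ∈ S, Relation.ReflTransGen
      ((P.restrict (fun d => π d ∈ S) h).Joined fun d => (⟨π d.1, d.2⟩ : S)) ⟨a, ha⟩ ⟨b, hb⟩ := by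
  induction hab with
  | refl => exact ⟨ha, .refl⟩
  | tail _ hbc ih =>
    obtain ⟨hb, hr⟩ := ih
    obtain ⟨d, rfl, rfl⟩ := hbc
    exact ⟨h d hb, hr.tail ⟨⟨d, hb⟩, rfl, rfl⟩⟩

/-- The component is the set of points reachable from `x`. Any closed connected set containing `x`
contains all reachable points because it is closed, and no others because it is connected. -/
theorem existsUnique_component (P : Pairing X) (x : κ) :
    ∃! S : Set κ, x ∈ S ∧ IsComponent π S P := by
  have : Std.Symm (P.Joined π) := ⟨fun a b h => h.symm⟩
  refine ⟨{y | Relation.ReflTransGen (P.Joined π) x y}, ⟨.refl, ?_, ⟨⟨x, .refl⟩⟩, ?_⟩, ?_⟩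
  · exact fun d hd => Relation.ReflTransGen.tail hd ⟨d, rfl, rfl⟩
  · rintro ⟨a, ha⟩ ⟨b, hb⟩
    exact (reflTransGen_restrict _ ha ((Std.Symm.symm _ _ ha).trans hb)).2
  · rintro S ⟨hx, hcl, -, hS⟩
    ext y
    constructor
    · intro hy
      refine Relation.ReflTransGen.lift Subtype.val ?_ _ _ (hS ⟨x, hx⟩ ⟨y, hy⟩)
      rintro a b ⟨d, rfl, rfl⟩
      exact ⟨d, rfl, rfl⟩
    · intro hy
      exact (reflTransGen_restrict hcl hx hy).1

variable (π)

/-- Double counting of pairings with a marked base point, grouped by the component `S` of that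
point: such a pairing is a point of `S`, a connected pairing over `S` and an arbitrary pairing of
the rest. Marking a point makes the component unique and later becomes the Euler operator. -/
theorem card_mul_card_pairing [Finite X] [Fintype (Set κ)] :
    Nat.card κ * Nat.card (Pairing X) = ∑ S : Set κ,
      Nat.card S * (connCount (fun d : {d // π d ∈ S} => (⟨π d.1, d.2⟩ : S)) *
        Nat.card (Pairing {d // ¬ π d ∈ S})) := by
  have : Finite κ := Finite.of_injective (fun k : κ => ({k} : Set κ)) Set.singleton_injective
  have e : (Σ S : Set κ, S × {P : Pairing X // IsComponent π S P}) ≃ κ × Pairing X := by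
    refine Equiv.ofBijective (fun R => (R.2.1, R.2.2)) ⟨?_, ?_⟩
    · rintro ⟨S, ⟨x, hx⟩, P, hP⟩ ⟨S', ⟨x', hx'⟩, P', hP'⟩ h
      obtain ⟨rfl, rfl⟩ := Prod.ext_iff.1 h
      obtain rfl := (existsUnique_component P x).unique ⟨hx, hP⟩ ⟨hx', hP'⟩
      rfl
    · rintro ⟨x, P⟩
      obtain ⟨S, ⟨hx, hP⟩, -⟩ := existsUnique_component (π := π) P x
      exact ⟨⟨S, ⟨x, hx⟩, P, hP⟩, rfl⟩
  rw [← Nat.card_prod, ← Nat.card_congr e, Nat.card_sigma]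
  refine Finset.sum_congr rfl fun S _ => ?_
  rw [Nat.card_prod]
  congr 1
  rw [connCount, ← Nat.card_prod]
  exact Nat.card_congr (Pairing.splitEquiv (fun d => π d ∈ S)
    fun P => P.Conn fun d : {d // π d ∈ S} => (⟨π d.1, d.2⟩ : S))

end Components

/-! ### Counting pairing schemes by their components -/

section Types

variable {N : ℕ}

/-- The number of dots of a dot diagram of type `v`. -/
def dotCount (v : Fin N → ℕ) : ℕ := ∑ j, v j * ((j : ℕ) + 1)

theorem card_cross (v : Fin N → ℕ) : Nat.card (Cross v) = ∑ j, v j := by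
  simp [Cross]

theorem card_dot (v : Fin N → ℕ) : Nat.card (Dot v) = dotCount v := by
  rw [Dot, Nat.card_sigma, Fintype.sum_sigma]
  simp [dotCount]

/-- The order of `∏ⱼ 𝔖_{v j} ⋉ (𝔖_{j+1})^{v j}`. -/
def symCount (v : Fin N → ℕ) : ℕ :=
  ∏ j, (v j).factorial * ((j : ℕ) + 1).factorial ^ v j

theorem symCount_pos (v : Fin N → ℕ) : 0 < symCount v :=
  Finset.prod_pos fun j _ => by positivity

/-- The type of a set of crosses: the number of its elements with `j + 1` legs, for every `j`. -/
def crossType {v : Fin N → ℕ} (S : Set (Cross v)) : Fin N →₀ ℕ :=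
  Finsupp.equivFunOnFinite.symm fun j => Nat.card {i : Fin (v j) // (⟨j, i⟩ : Cross v) ∈ S}

theorem crossType_apply {v : Fin N → ℕ} (S : Set (Cross v)) (j : Fin N) :
    crossType S j = Nat.card {i : Fin (v j) // (⟨j, i⟩ : Cross v) ∈ S} := rfl

theorem crossType_add_compl {v : Fin N →₀ ℕ} (S : Set (Cross v)) :
    crossType S + crossType Sᶜ = v := by
  classical
  ext j
  rw [Finsupp.add_apply, crossType_apply, crossType_apply, ← Nat.card_sum]
  refine (Nat.card_congr (Equiv.sumCompl fun i : Fin (v j) => (⟨j, i⟩ : Cross v) ∈ S)).trans ?_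
  simp

/-- A set of crosses is in bijection with the crosses of a dot diagram of its type. -/
def crossEquiv {v : Fin N → ℕ} (S : Set (Cross v)) : S ≃ Cross (crossType S) where
  toFun c := ⟨c.1.1, Finite.equivFin {i // (⟨c.1.1, i⟩ : Cross v) ∈ S} ⟨c.1.2, c.2⟩⟩
  invFun c := ⟨⟨c.1, ((Finite.equivFin {i // (⟨c.1, i⟩ : Cross v) ∈ S}).symm c.2).1⟩,
    ((Finite.equivFin {i // (⟨c.1, i⟩ : Cross v) ∈ S}).symm c.2).2⟩
  left_inv c := by
    refine Subtype.ext (Sigma.ext rfl (heq_of_eq ?_))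
    exact congrArg Subtype.val (Equiv.symm_apply_apply _ _)
  right_inv c := Sigma.ext rfl (heq_of_eq (Equiv.apply_symm_apply _ _))

/-- The dots at a set of crosses are in bijection with the dots of a dot diagram of its type. -/
def dotEquiv {v : Fin N → ℕ} (S : Set (Cross v)) :
    {d : Dot v // d.1 ∈ S} ≃ Dot (crossType S) :=
  (Equiv.subtypeSigmaEquiv (fun c : Cross v => Fin ((c.1 : ℕ) + 1)) (· ∈ S)).trans
    (Equiv.sigmaCongr (crossEquiv S) fun _ => Equiv.refl _)

theorem dotEquiv_fst {v : Fin N → ℕ} (S : Set (Cross v)) (d : {d : Dot v // d.1 ∈ S}) :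
    (dotEquiv S d).1 = crossEquiv S ⟨d.1.1, d.2⟩ := rfl

theorem card_sets_of_card (n k : ℕ) :
    Nat.card {T : Set (Fin n) // Nat.card T = k} = n.choose k := by
  classical
  have e : {T : Finset (Fin n) // T.card = k} ≃ {T : Set (Fin n) // Nat.card T = k} :=
    Equiv.subtypeEquiv Fintype.finsetEquivSet fun T => by simp
  rw [← Nat.card_congr e, Nat.card_eq_fintype_card, Fintype.card_finset_len, Fintype.card_fin]

/-- A set of crosses amounts to an independent choice, for each `j`, of a subset of the `v j`
crosses with `j + 1` legs. -/
theorem card_crossType_eq (v : Fin N → ℕ) (u : Fin N →₀ ℕ) :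
    Nat.card {S : Set (Cross v) // crossType S = u} = ∏ j, (v j).choose (u j) := by
  have e : {S : Set (Cross v) // crossType S = u} ≃
      ∀ j, {T : Set (Fin (v j)) // Nat.card T = u j} :=
    ((Equiv.piCurry fun (j : Fin N) (_ : Fin (v j)) => Prop).subtypeEquiv fun S => by
      rw [Finsupp.ext_iff]; rfl).trans
      (Equiv.subtypePiEquivPi (p := fun j (T : Set (Fin (v j))) => Nat.card T = u j))
  rw [Nat.card_congr e, Nat.card_pi]
  exact Finset.prod_congr rfl fun j _ => card_sets_of_card _ _

/-- The binomials that count the ways to distribute the crosses are absorbed by the group orders.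
Hence counts divided by `symCount` convolve like coefficients of ordinary power series. -/
theorem choose_mul_symCount {u w v : Fin N →₀ ℕ} (h : u + w = v) :
    (∏ j, (v j).choose (u j)) * (symCount u * symCount w) = symCount v := by
  subst h
  rw [symCount, symCount, symCount, ← Finset.prod_mul_distrib, ← Finset.prod_mul_distrib]
  refine Finset.prod_congr rfl fun j _ => ?_
  rw [Finsupp.add_apply, ← Nat.add_choose_mul_factorial_mul_factorial (u j) (w j), pow_add,
    Nat.choose_symm_add]
  ring

/-- In `card_mul_card_pairing` the summand at `S` depends only on the types of `S` and of its
complement, so the sets can be collected by type. -/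
theorem sum_mul_pairingNumber (v : Fin N →₀ ℕ) :
    (∑ j, v j) * pairingNumber (dotCount v) = ∑ p ∈ Finset.HasAntidiagonal.antidiagonal v,
      (∏ j, (v j).choose (p.1 j)) * ((∑ j, p.1 j) *
        (connCount (Sigma.fst : Dot p.1 → Cross p.1) * pairingNumber (dotCount p.2))) := by
  classical
  have : Fintype (Set (Cross v)) := Fintype.ofFinite _
  have h := card_mul_card_pairing (Sigma.fst : Dot v → Cross v)
  rw [card_cross, card_pairing _ _ rfl, card_dot] at h
  rw [h, ← Finset.sum_fiberwise_of_maps_to (s := Finset.univ)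
    (t := Finset.HasAntidiagonal.antidiagonal v)
    (g := fun S : Set (Cross v) => (crossType S, crossType Sᶜ))
    (fun S _ => by simpa using crossType_add_compl S)]
  refine Finset.sum_congr rfl fun p hp => ?_
  have hp' : p.1 + p.2 = v := by simpa using hp
  -- The two types add up to `v`, so the type of `S` already determines that of the complement.
  have hfib : (Finset.univ.filter fun S : Set (Cross v) => (crossType S, crossType Sᶜ) = p) =
      Finset.univ.filter fun S : Set (Cross v) => crossType S = p.1 := by
    ext S
    have := crossType_add_compl S
    simp only [Finset.mem_filter, Finset.mem_univ, true_and, Prod.ext_iff]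
    refine ⟨fun h => h.1, fun h => ⟨h, ?_⟩⟩
    exact add_left_cancel ((h ▸ this).trans hp'.symm)
  rw [Finset.sum_congr rfl (g := fun _ => (∑ j, p.1 j) *
        (connCount (Sigma.fst : Dot p.1 → Cross p.1) * pairingNumber (dotCount p.2))),
    Finset.sum_const, hfib, smul_eq_mul, ← card_crossType_eq, Nat.card_eq_fintype_card,
    Fintype.card_subtype]
  intro S hS
  obtain rfl : (crossType S, crossType Sᶜ) = p := (Finset.mem_filter.1 hS).2
  rw [Nat.card_congr (crossEquiv S), card_cross,
    connCount_congr (dotEquiv S) (crossEquiv S) (π' := Sigma.fst) (dotEquiv_fst S),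
    card_pairing _ _ rfl]
  rw [← card_dot (crossType Sᶜ), ← Nat.card_congr (dotEquiv Sᶜ)]
  rfl

/-- The generating series of pairing schemes, weighted by the orders of the symmetry groups. -/
def pairingSeries (N : ℕ) : MvPowerSeries (Fin N) ℚ := fun v =>
  (pairingNumber (dotCount v) : ℚ) / symCount v

/-- The generating series of connected pairing schemes. -/
def connSeries (N : ℕ) : MvPowerSeries (Fin N) ℚ := fun v =>
  (connCount (Sigma.fst : Dot v → Cross v) : ℚ) / symCount v

theorem coeff_pairingSeries (v : Fin N →₀ ℕ) : MvPowerSeries.coeff v (pairingSeries N) =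
    (pairingNumber (dotCount v) : ℚ) / symCount v := rfl

theorem coeff_connSeries (v : Fin N →₀ ℕ) : MvPowerSeries.coeff v (connSeries N) =
    (connCount (Sigma.fst : Dot v → Cross v) : ℚ) / symCount v := rfl

theorem constantCoeff_pairingSeries : MvPowerSeries.constantCoeff (pairingSeries N) = 1 := by
  rw [← MvPowerSeries.coeff_zero_eq_constantCoeff_apply, coeff_pairingSeries]
  simp [dotCount, symCount, pairingNumber]

theorem constantCoeff_connSeries : MvPowerSeries.constantCoeff (connSeries N) = 0 := by
  rw [← MvPowerSeries.coeff_zero_eq_constantCoeff_apply, coeff_connSeries]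
  have : connCount (Sigma.fst : Dot (⇑(0 : Fin N →₀ ℕ)) → Cross (⇑(0 : Fin N →₀ ℕ))) = 0 := by
    refine Nat.card_eq_zero.2 (Or.inl ⟨?_⟩)
    rintro ⟨P, ⟨⟨j, i⟩⟩, -⟩
    exact i.elim0
  rw [this, Nat.cast_zero, zero_div]

/-- This is `E A = A * E C` read off at `v`: the degree of `v` is its number of crosses, that is,
the number of possible marks. -/
theorem degree_mul_coeff_pairingSeries (v : Fin N →₀ ℕ) :
    (v.degree : ℚ) * MvPowerSeries.coeff v (pairingSeries N) =
      ∑ p ∈ Finset.HasAntidiagonal.antidiagonal v,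
        p.1.degree * MvPowerSeries.coeff p.1 (connSeries N) *
        MvPowerSeries.coeff p.2 (pairingSeries N) := by
  have h := congrArg (Nat.cast : ℕ → ℚ) (sum_mul_pairingNumber v)
  have hdeg : ∀ u : Fin N →₀ ℕ, u.degree = ∑ j, u j := fun u => Finsupp.degree_eq_sum u
  rw [coeff_pairingSeries, ← mul_div_assoc, hdeg, ← Nat.cast_mul, h, Nat.cast_sum,
    Finset.sum_div]
  refine Finset.sum_congr rfl fun p hp => ?_
  have hp' : p.1 + p.2 = v := by simpa using hp
  have h1 := congrArg (Nat.cast : ℕ → ℚ) (choose_mul_symCount hp')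
  have h2 : (symCount p.1 : ℚ) ≠ 0 := by exact_mod_cast (symCount_pos p.1).ne'
  have h3 : (symCount p.2 : ℚ) ≠ 0 := by exact_mod_cast (symCount_pos p.2).ne'
  have h4 : (symCount v : ℚ) ≠ 0 := by exact_mod_cast (symCount_pos v).ne'
  rw [coeff_pairingSeries, coeff_connSeries, hdeg, div_eq_iff h4, ← h1]
  push_cast
  field_simp

end Types

/-! ### The formal logarithm -/

section Log

variable {σ : Type*}

/-- The Euler operator, which multiplies each monomial by its degree. -/
def eulerOp (F : MvPowerSeries σ ℚ) : MvPowerSeries σ ℚ := fun n =>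
  n.degree * MvPowerSeries.coeff n F

theorem coeff_eulerOp (F : MvPowerSeries σ ℚ) (n : σ →₀ ℕ) :
    MvPowerSeries.coeff n (eulerOp F) = n.degree * MvPowerSeries.coeff n F := rfl

theorem eulerOp_mul (F G : MvPowerSeries σ ℚ) :
    eulerOp (F * G) = eulerOp F * G + F * eulerOp G := by
  classical
  ext n
  rw [map_add, coeff_eulerOp, MvPowerSeries.coeff_mul, MvPowerSeries.coeff_mul,
    MvPowerSeries.coeff_mul, Finset.mul_sum, ← Finset.sum_add_distrib]
  refine Finset.sum_congr rfl fun p hp => ?_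
  rw [← Finset.HasAntidiagonal.mem_antidiagonal.1 hp, coeff_eulerOp, coeff_eulerOp, map_add]
  push_cast
  ring

theorem eulerOp_pow (F : MvPowerSeries σ ℚ) (k : ℕ) :
    eulerOp (F ^ (k + 1)) = ((k : ℚ) + 1) • (F ^ k * eulerOp F) := by
  induction k with
  | zero => simp
  | succ k ih =>
    rw [pow_succ, eulerOp_mul, ih]
    push_cast
    rw [smul_mul_assoc, mul_right_comm, ← pow_succ,
      add_smul ((k : ℚ) + 1) (1 : ℚ) (F ^ (k + 1) * eulerOp F),
      one_smul]

theorem eulerOp_one_add (F : MvPowerSeries σ ℚ) : eulerOp (1 + F) = eulerOp F := by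
  classical
  ext n
  rw [coeff_eulerOp, coeff_eulerOp, map_add, MvPowerSeries.coeff_one]
  split_ifs with h <;> simp [h]

/-- The order of `B ^ k` is at least `k`. Each coefficient of the logarithm therefore involves only
finitely many powers. -/
theorem coeff_pow_mul_eq_zero {B : MvPowerSeries σ ℚ} (hB : MvPowerSeries.constantCoeff B = 0)
    (G : MvPowerSeries σ ℚ) {n : σ →₀ ℕ} {k : ℕ} (hk : n.degree < k) :
    MvPowerSeries.coeff n (B ^ k * G) = 0 := by
  apply MvPowerSeries.coeff_of_lt_order
  have h1 := MvPowerSeries.le_order_pow_of_constantCoeff_eq_zero k hB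
  have h2 := MvPowerSeries.le_order_mul (f := B ^ k) (g := G)
  calc (n.degree : ℕ∞) < k := by exact_mod_cast hk
    _ ≤ (B ^ k).order := h1
    _ ≤ (B ^ k).order + G.order := le_self_add
    _ ≤ _ := h2

/-- A power series whose logarithmic derivative is the derivative of `C` has logarithm `C`. -/
theorem formalLog_eq_of_eulerOp {A C : MvPowerSeries σ ℚ}
    (hA : MvPowerSeries.constantCoeff A = 1) (hC : MvPowerSeries.constantCoeff C = 0)
    (h : eulerOp A = A * eulerOp C) : formalLog A = C := by
  set B := A - 1 with hBdef
  have hB : MvPowerSeries.constantCoeff B = 0 := by simp [hBdef, hA]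
  have hAB : A = 1 + B := by simp [hBdef]
  have hA0 : A ≠ 0 := by rintro rfl; simp at hA
  let c : ℕ → ℚ := fun d => PowerSeries.coeff d (PowerSeries.log ℚ)
  -- Differentiating the logarithm cancels its denominators and leaves the geometric series.
  have hc : ∀ d : ℕ, c (d + 1) * (d + 1) = (-1) ^ d := fun d => by
    have : (d : ℚ) + 1 ≠ 0 := by positivity
    simp [c, PowerSeries.coeff_log]
    field_simp
    ring
  have hc0 : c 0 = 0 := by simp [c]
  let L : ℕ → MvPowerSeries σ ℚ := fun M => ∑ d ∈ Finset.range (M + 1), c d • B ^ d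
  have hE : ∀ M, eulerOp (L M) = ∑ d ∈ Finset.range M, ((-1 : ℚ) ^ d) • (B ^ d * eulerOp B) := by
    intro M
    ext n
    rw [coeff_eulerOp, map_sum, map_sum, Finset.sum_range_succ',
      hc0, zero_smul, map_zero, add_zero, Finset.mul_sum]
    refine Finset.sum_congr rfl fun d _ => ?_
    rw [map_smul, map_smul, smul_eq_mul, mul_left_comm, ← coeff_eulerOp, eulerOp_pow, map_smul,
      smul_eq_mul, smul_eq_mul, ← mul_assoc, hc]
  -- Telescoping of the finite geometric series: `(1 + B) * ∑ (-B) ^ d = 1 - (-B) ^ M`, the sum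
  -- being over `d < M`.
  have hmul : ∀ M, A * eulerOp (L M) = eulerOp B - ((-1 : ℚ) ^ M) • (B ^ M * eulerOp B) := by
    intro M
    rw [hE]
    induction M with
    | zero => simp
    | succ M ih =>
      rw [Finset.sum_range_succ, mul_add, ih, hAB]
      simp only [pow_succ, mul_neg, mul_one, neg_smul, mul_smul_comm, add_mul, one_mul, smul_add]
      rw [← mul_assoc, mul_comm B]
      abel
  -- The factor `A` is cancelled in the domain of power series, so no inverse of `A` is needed.
  have hdiff : ∀ M, eulerOp (L M) = eulerOp C - ((-1 : ℚ) ^ M) • (B ^ M * eulerOp C) := by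
    intro M
    apply mul_left_cancel₀ hA0
    have hEB : eulerOp B = A * eulerOp C := by rw [← h, hAB, eulerOp_one_add]
    rw [hmul, hEB, mul_sub, mul_smul_comm, mul_left_comm]
  have hlog : ∀ n : σ →₀ ℕ, MvPowerSeries.coeff n (formalLog A) =
      MvPowerSeries.coeff n (L (n.degree + 1)) := by
    intro n
    rw [formalLog, PowerSeries.coeff_subst (PowerSeries.HasSubst.of_constantCoeff_zero hB),
      finsum_eq_sum_of_support_subset (s := Finset.range (n.degree + 1 + 1)), map_sum]
    · rfl
    · intro d hd
      by_contra hlt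
      refine hd ?_
      have := coeff_pow_mul_eq_zero hB 1 (n := n) (k := d) (by simp at hlt; omega)
      rw [mul_one] at this
      change _ • MvPowerSeries.coeff n (B ^ d) = 0
      rw [this, smul_zero]
  ext n
  -- The Euler operator loses exactly the constant term, which is compared separately. In positive
  -- degree the truncation at `n.degree + 1` makes the error term vanish.
  by_cases hn : n = 0
  · subst hn
    rw [hlog, MvPowerSeries.coeff_zero_eq_constantCoeff_apply,
      MvPowerSeries.coeff_zero_eq_constantCoeff_apply, hC, map_sum]
    refine Finset.sum_eq_zero fun d _ => ?_
    rcases d with _ | d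
    · simp [hc0]
    · change MvPowerSeries.coeff 0 (c (d + 1) • B ^ (d + 1)) = 0
      rw [map_smul, MvPowerSeries.coeff_zero_eq_constantCoeff_apply, map_pow, hB]
      simp
  · have h1 := congrArg (MvPowerSeries.coeff n) (hdiff (n.degree + 1))
    rw [map_sub, map_smul, coeff_pow_mul_eq_zero hB _ (Nat.lt_succ_self _), smul_zero, sub_zero,
      coeff_eulerOp, coeff_eulerOp] at h1
    rw [hlog]
    refine mul_left_cancel₀ ?_ h1
    simpa [Finsupp.degree_eq_zero_iff] using hn

theorem formalLog_pairingSeries (N : ℕ) : formalLog (pairingSeries N) = connSeries N := by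
  classical
  refine formalLog_eq_of_eulerOp constantCoeff_pairingSeries constantCoeff_connSeries ?_
  ext n
  rw [coeff_eulerOp, degree_mul_coeff_pairingSeries, mul_comm, MvPowerSeries.coeff_mul]
  rfl

end Log

/-! ### Invariants of isomorphism classes of graphs -/

namespace MultiGraph

theorem Isomorphic.symm {Γ Δ : MultiGraph} (h : Γ.Isomorphic Δ) : Δ.Isomorphic Γ :=
  isoSetoid.symm h

theorem Isomorphic.trans {Γ Δ Λ : MultiGraph} (h : Γ.Isomorphic Δ) (h' : Δ.Isomorphic Λ) :
    Γ.Isomorphic Λ :=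
  isoSetoid.trans h h'

theorem degree_map {Γ Δ : MultiGraph} (φ : Γ.V ≃ Δ.V) (ψ : Γ.E ≃ Δ.E)
    (h : ∀ e, Δ.ends (ψ e) = (Γ.ends e).map φ) (x : Γ.V) : Δ.degree (φ x) = Γ.degree x := by
  rw [degree, degree]
  congr 1
  · refine (Nat.card_congr (ψ.subtypeEquiv fun e => ?_)).symm
    rw [h, Sym2.mem_map]
    simp
  · refine (Nat.card_congr (ψ.subtypeEquiv fun e => ?_)).symm
    rw [h, ← Sym2.map_mk, (Sym2.map.injective φ.injective).eq_iff]

theorem Isomorphic.vertexCount_eq {Γ Δ : MultiGraph} (h : Γ.Isomorphic Δ) (N : ℕ) :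
    Γ.vertexCount N = Δ.vertexCount N := by
  obtain ⟨φ, ψ, h⟩ := h
  funext j
  exact Nat.card_congr (φ.subtypeEquiv fun x => by rw [degree_map φ ψ h])

theorem Isomorphic.degreesIn {Γ Δ : MultiGraph} (h : Γ.Isomorphic Δ) {N : ℕ}
    (hΓ : Γ.DegreesIn N) : Δ.DegreesIn N := by
  obtain ⟨φ, ψ, h⟩ := h
  intro x
  have := hΓ (φ.symm x)
  rwa [← degree_map φ ψ h, φ.apply_symm_apply] at this

theorem Isomorphic.connected {Γ Δ : MultiGraph} (h : Γ.Isomorphic Δ) (hΓ : Γ.Connected) :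
    Δ.Connected := by
  obtain ⟨φ, ψ, h⟩ := h
  obtain ⟨⟨a⟩, hc⟩ := hΓ
  refine ⟨⟨φ a⟩, fun x y => ?_⟩
  have := Relation.ReflTransGen.lift φ (p := fun a b => ∃ e : Δ.E, Δ.ends e = s(a, b))
    (fun a b ⟨e, he⟩ => ⟨ψ e, by rw [h, he, Sym2.map_mk]⟩) _ _ (hc (φ.symm x) (φ.symm y))
  simpa [Function.onFun] using this

/-- With the two ends of each edge ordered, the edges at `x` are a union of two sets and the loops
at `x` their intersection, so the degree is the sum of the sizes of the two sets. -/
theorem card_halfEdges (Γ : MultiGraph) (w : Γ.E × Bool → Γ.V)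
    (hw : ∀ e, Γ.ends e = s(w (e, false), w (e, true))) (x : Γ.V) :
    Nat.card {h : Γ.E × Bool // w h = x} = Γ.degree x := by
  have E1 : {h : Γ.E × Bool // w h = x} ≃
      {e : Γ.E // w (e, false) = x} ⊕ {e : Γ.E // w (e, true) = x} :=
    { toFun := fun h => match h with
        | ⟨(e, false), p⟩ => Sum.inl ⟨e, p⟩
        | ⟨(e, true), p⟩ => Sum.inr ⟨e, p⟩
      invFun := fun s => match s with
        | Sum.inl e => ⟨(e.1, false), e.2⟩
        | Sum.inr e => ⟨(e.1, true), e.2⟩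
      left_inv := by rintro ⟨⟨e, _ | _⟩, p⟩ <;> rfl
      right_inv := by rintro (e | e) <;> rfl }
  rw [Nat.card_congr E1, Nat.card_sum, MultiGraph.degree]
  have c : ∀ p : Γ.E → Prop, Nat.card {e // p e} = {e | p e}.ncard := fun p =>
    Nat.card_coe_set_eq {e | p e}
  rw [c, c, c, c, ← Set.ncard_union_add_ncard_inter]
  congr 2
  · ext e
    simp [hw, Sym2.mem_iff, eq_comm]
  · ext e
    simp [hw]

end MultiGraph

/-! ### The action of the symmetry group on pairing schemes -/

namespace PairingScheme

variable {N : ℕ} {v : Fin N → ℕ}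

theorem ext_partner {P Q : PairingScheme v} (h : ∀ d, P.partner d = Q.partner d) : P = Q := by
  obtain ⟨p, _, _⟩ := P
  obtain ⟨q, _, _⟩ := Q
  obtain rfl : p = q := funext h
  rfl

/-- Pairing schemes of type `v` are pairings of the dots. -/
def equivPairing (v : Fin N → ℕ) : PairingScheme v ≃ Pairing (Dot v) where
  toFun P := ⟨P.partner, P.partner_partner, P.partner_ne⟩
  invFun P := ⟨P.partner, P.partner_partner, P.partner_ne⟩
  left_inv _ := rfl
  right_inv _ := rfl

instance : Finite (PairingScheme v) := Finite.of_equiv _ (equivPairing v).symm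

instance : MulAction (dotSymmetry v) (PairingScheme v) where
  smul g P :=
    { partner := fun d => g.1 (P.partner (g.1⁻¹ d))
      partner_partner := fun d => by simp [P.partner_partner]
      partner_ne := fun d hd => P.partner_ne (g.1⁻¹ d) (g.1.injective (by rw [hd]; simp)) }
  one_smul P := rfl
  mul_smul g h P := by
    refine ext_partner fun d => ?_
    change (g * h).1 (P.partner ((g * h).1⁻¹ d)) = g.1 (h.1 (P.partner (h.1⁻¹ (g.1⁻¹ d))))
    simp

theorem smul_partner (g : dotSymmetry v) (P : PairingScheme v) (d : Dot v) :
    (g • P).partner (g.1 d) = g.1 (P.partner d) := by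
  change g.1 (P.partner (g.1⁻¹ (g.1 d))) = _
  simp

theorem smul_eq_iff (g : dotSymmetry v) (P Q : PairingScheme v) :
    g • P = Q ↔ ∀ d, Q.partner (g.1 d) = g.1 (P.partner d) := by
  constructor
  · rintro rfl d
    exact smul_partner g P d
  · intro h
    refine ext_partner fun d => ?_
    obtain ⟨d, rfl⟩ := g.1.surjective d
    rw [smul_partner, h]

/-- Orbit-stabilizer; `isotropy` is a subgroup of all permutations of the dots and must first be
identified with the stabilizer inside `dotSymmetry`. -/
theorem card_orbit_mul_card_isotropy (P : PairingScheme v) :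
    Nat.card (MulAction.orbit (dotSymmetry v) P) * Nat.card P.isotropy =
      Nat.card (dotSymmetry v) := by
  have hle : P.isotropy ≤ dotSymmetry v := fun g hg => hg.1
  have hst : MulAction.stabilizer (dotSymmetry v) P = P.isotropy.subgroupOf (dotSymmetry v) := by
    ext g
    rw [MulAction.mem_stabilizer_iff, smul_eq_iff, Subgroup.mem_subgroupOf]
    exact ⟨fun h => ⟨g.2, h⟩, fun h => h.2⟩
  rw [← Nat.card_congr (Subgroup.subgroupOfEquivOfLe hle).toEquiv, ← hst,
    ← Nat.card_prod]
  exact Nat.card_congr (MulAction.orbitProdStabilizerEquivGroup _ P)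

end PairingScheme

theorem card_dotSymmetry {N : ℕ} (v : Fin N → ℕ) : Nat.card (dotSymmetry v) = symCount v := by
  let F : (∀ j : Fin N, Equiv.Perm (Fin (v j))) ×
      (∀ c : Cross v, Equiv.Perm (Fin ((c.1 : ℕ) + 1))) → dotSymmetry v := fun R =>
    ⟨Equiv.sigmaCongr (Equiv.sigmaCongrRight R.1) R.2, R.1, R.2, fun c k => rfl⟩
  have hF : ∀ R (c : Cross v) (k : Fin ((c.1 : ℕ) + 1)),
      (F R).1 ⟨c, k⟩ = ⟨⟨c.1, R.1 c.1 c.2⟩, R.2 c k⟩ := fun R c k => rfl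
  have hbij : Function.Bijective F := by
    constructor
    · rintro R R' h
      have h1 : ∀ (c : Cross v) (k : Fin ((c.1 : ℕ) + 1)),
          (⟨⟨c.1, R.1 c.1 c.2⟩, R.2 c k⟩ : Dot v) = ⟨⟨c.1, R'.1 c.1 c.2⟩, R'.2 c k⟩ := fun c k => by
        rw [← hF, ← hF, h]
      have h2 : R.1 = R'.1 := by
        funext j
        ext1 i
        -- Every cross has at least one leg, here number `0`, so the action on dots reveals the
        -- permutation of crosses.
        have := congrArg Sigma.fst (h1 ⟨j, i⟩ 0)
        simpa using this
      refine Prod.ext h2 (funext fun c => Equiv.ext fun k => ?_)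
      have := h1 c k
      rw [h2] at this
      simpa using this
    · rintro ⟨g, π, ρ, h⟩
      exact ⟨(π, ρ), Subtype.ext (Equiv.ext fun d => (h d.1 d.2).symm)⟩
  rw [← Nat.card_eq_of_bijective F hbij, Nat.card_prod, Nat.card_pi, Nat.card_pi,
    Fintype.prod_sigma, symCount, ← Finset.prod_mul_distrib]
  refine Finset.prod_congr rfl fun j _ => ?_
  simp [Nat.card_eq_fintype_card, Fintype.card_perm]

/-- The bijection of unordered pairs induced by a bijection. -/
def sym2Equiv {α β : Type*} (e : α ≃ β) : Sym2 α ≃ Sym2 β where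
  toFun := Sym2.map e
  invFun := Sym2.map e.symm
  left_inv p := by simp [Sym2.map_map]
  right_inv p := by simp [Sym2.map_map]

/-- A permutation of the dots lying over a permutation of the crosses maps fibres bijectively. It
therefore preserves the number of legs, which is all that membership in the group requires. -/
theorem mem_dotSymmetry_of_cross {N : ℕ} {v : Fin N → ℕ} (g : Equiv.Perm (Dot v))
    (φ : Equiv.Perm (Cross v)) (h : ∀ d, (g d).1 = φ d.1) : g ∈ dotSymmetry v := by
  have hcard : ∀ c : Cross v, Nat.card {d : Dot v // d.1 = c} = (c.1 : ℕ) + 1 := fun c => by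
    rw [Nat.card_congr (Equiv.sigmaSubtype c)]
    simp
  have hφ : ∀ c, (φ c).1 = c.1 := fun c => by
    have h1 : Nat.card {d : Dot v // d.1 = c} = Nat.card {d : Dot v // d.1 = φ c} :=
      Nat.card_congr (g.subtypeEquiv fun d => by rw [h]; simp)
    rw [hcard, hcard] at h1
    exact Fin.ext (by omega)
  let π : ∀ j : Fin N, Equiv.Perm (Fin (v j)) := fun j =>
    ((Equiv.sigmaSubtype j).symm.trans (φ.subtypeEquiv fun c => by rw [hφ])).trans
      (Equiv.sigmaSubtype j)
  have hsub : ∀ {α : Type} {β : α → Type} (a : α) (x : {s : Sigma β // s.1 = a}),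
      (⟨a, Equiv.sigmaSubtype a x⟩ : Sigma β) = x.1 := by
    rintro α β a ⟨x, rfl⟩
    rfl
  have hπ : ∀ c : Cross v, (⟨c.1, π c.1 c.2⟩ : Cross v) = φ c := fun c =>
    hsub c.1 (φ.subtypeEquiv (fun c => by rw [hφ]) ((Equiv.sigmaSubtype c.1).symm c.2))
  let e : ∀ c : Cross v, {d : Dot v // d.1 = c} ≃
      {d : Dot v // d.1 = (⟨c.1, π c.1 c.2⟩ : Cross v)} := fun c =>
    g.subtypeEquiv fun d => by rw [h, hπ]; simp
  let ρ : ∀ c : Cross v, Equiv.Perm (Fin ((c.1 : ℕ) + 1)) := fun c =>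
    ((Equiv.sigmaSubtype c).symm.trans (e c)).trans
      (Equiv.sigmaSubtype (⟨c.1, π c.1 c.2⟩ : Cross v))
  exact ⟨π, ρ, fun c k => (hsub (⟨c.1, π c.1 c.2⟩ : Cross v)
    (e c ((Equiv.sigmaSubtype c).symm k))).symm⟩

/-! ### Feynman diagrams of pairing schemes -/

namespace PairingScheme

variable {N : ℕ} {v : Fin N → ℕ}

/-- The half-edges of the Feynman diagram, after the choice of an orientation of each edge. -/
def halfEdge (P : PairingScheme v) (r : P.graph.E → Dot v) : P.graph.E × Bool → Dot v
  | (e, false) => r e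
  | (e, true) => P.partner (r e)

/-- Each dot lies in exactly one pair, and since no dot is its own partner it occupies exactly one
of the two positions there. -/
theorem halfEdge_bijective (P : PairingScheme v) (r : P.graph.E → Dot v)
    (hr : ∀ e, e.1 = s(r e, P.partner (r e))) : Function.Bijective (P.halfEdge r) := by
  have hedge : ∀ e b, e.1 = s(P.halfEdge r (e, b), P.partner (P.halfEdge r (e, b))) := by
    rintro e (_ | _)
    · exact hr e
    · rw [halfEdge, P.partner_partner, hr e, Sym2.eq_swap]
  constructor
  · rintro ⟨e, b⟩ ⟨e', b'⟩ h
    obtain rfl : e = e' := Subtype.ext (by rw [hedge e b, hedge e' b', h])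
    rcases b with _ | _ <;> rcases b' with _ | _
    · rfl
    · exact (P.partner_ne _ h.symm).elim
    · exact (P.partner_ne _ h).elim
    · rfl
  · intro d
    let e : P.graph.E := ⟨s(d, P.partner d), d, rfl⟩
    have h : s(d, P.partner d) = s(r e, P.partner (r e)) := hr e
    rcases Sym2.eq_iff.1 h with h | h
    · exact ⟨(e, false), h.1.symm⟩
    · exact ⟨(e, true), h.1.symm⟩

/-- The vertices of the Feynman diagram are the crosses. -/
def vertexEquiv (P : PairingScheme v) : P.graph.V ≃ Cross v := Equiv.refl _

theorem graph_degree (P : PairingScheme v) (c : P.graph.V) :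
    P.graph.degree c = ((P.vertexEquiv c).1 : ℕ) + 1 := by
  choose r hr using fun e : P.graph.E => e.2
  rw [← P.graph.card_halfEdges (fun h => P.vertexEquiv.symm (P.halfEdge r h).1)
      (fun e => congrArg (Sym2.map _) (hr e)),
    Nat.card_congr ((Equiv.ofBijective _ (P.halfEdge_bijective r hr)).subtypeEquiv
      (p := fun h => P.vertexEquiv.symm (P.halfEdge r h).1 = c)
      (q := fun d => d.1 = P.vertexEquiv c) fun d => Iff.rfl),
    Nat.card_congr (Equiv.sigmaSubtype _)]
  simp

theorem graph_degreesIn (P : PairingScheme v) : P.graph.DegreesIn N := fun c => by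
  rw [graph_degree]
  have := (P.vertexEquiv c).1.2
  omega

theorem graph_vertexCount (P : PairingScheme v) : P.graph.vertexCount N = v := by
  funext j
  have e : {c : P.graph.V // P.graph.degree c = (j : ℕ) + 1} ≃ {c : Cross v // c.1 = j} :=
    P.vertexEquiv.subtypeEquiv fun c => by
      rw [graph_degree, Fin.ext_iff]
      omega
  rw [MultiGraph.vertexCount, Nat.card_congr e, Nat.card_congr (Equiv.sigmaSubtype j)]
  simp

theorem graph_smul_isomorphic (g : dotSymmetry v) (P : PairingScheme v) :
    P.graph.Isomorphic (g • P).graph := by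
  obtain ⟨π, ρ, h⟩ := g.2
  have hmap : ∀ p : Sym2 (Dot v), Sym2.map Sigma.fst (Sym2.map g.1 p) =
      Sym2.map (Equiv.sigmaCongrRight π) (Sym2.map Sigma.fst p) := fun p => by
    rw [Sym2.map_map, Sym2.map_map]
    congr 1
    funext d
    exact congrArg Sigma.fst (h d.1 d.2)
  refine ⟨Equiv.sigmaCongrRight π, (sym2Equiv g.1).subtypeEquiv ?_, ?_⟩
  · intro p
    constructor
    · rintro ⟨d, rfl⟩
      exact ⟨g.1 d, by rw [smul_partner]; rfl⟩
    · rintro ⟨d, hd⟩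
      obtain ⟨d, rfl⟩ := g.1.surjective d
      refine ⟨d, (sym2Equiv g.1).injective ?_⟩
      rw [hd, smul_partner]
      rfl
  · rintro ⟨p, d, rfl⟩
    exact hmap s(d, P.partner d)

/-- A graph isomorphism lifts to the dots once the edges are oriented compatibly: a dot goes to the
dot in the same position of the image edge. The lift lies over a permutation of the crosses, hence
belongs to the symmetry group. -/
theorem graph_isomorphic_iff (P Q : PairingScheme v) :
    P.graph.Isomorphic Q.graph ↔ Q ∈ MulAction.orbit (dotSymmetry v) P := by
  constructor
  · rintro ⟨φ₀, ψ, h⟩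
    let φ : Cross v ≃ Cross v := φ₀
    have h' : ∀ e, Sym2.map Sigma.fst (ψ e).1 = Sym2.map φ (Sym2.map Sigma.fst e.1) := h
    choose r hr using fun e : P.graph.E => e.2
    -- Of the two orientations of the image edge, one is compatible with `φ`; for a loop either
    -- would do.
    have hex : ∀ e : P.graph.E, ∃ d : Dot v, (ψ e).1 = s(d, Q.partner d) ∧
        d.1 = φ (r e).1 ∧ (Q.partner d).1 = φ (P.partner (r e)).1 := by
      intro e
      obtain ⟨d, hd⟩ := (ψ e).2
      have h1 := h' e
      rw [hd, hr e, Sym2.map_mk, Sym2.map_mk, Sym2.map_mk, Sym2.eq_iff] at h1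
      rcases h1 with h1 | h1
      · exact ⟨d, hd, h1⟩
      · exact ⟨Q.partner d, by rw [Q.partner_partner, hd, Sym2.eq_swap], h1.2,
          by rw [Q.partner_partner]; exact h1.1⟩
    choose r' hr' h1 h2 using hex
    let θ := Equiv.ofBijective _ (P.halfEdge_bijective r hr)
    let θ' := Equiv.ofBijective _ (Q.halfEdge_bijective (fun e => r' (ψ.symm e)) fun e => by
      rw [← hr', Equiv.apply_symm_apply])
    let g : Equiv.Perm (Dot v) :=
      (θ.symm.trans (Equiv.prodCongr ψ (Equiv.refl Bool))).trans θ'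
    have hg0 : ∀ e, g (r e) = r' e := fun e => by
      have : θ.symm (r e) = (e, false) := θ.symm_apply_eq.2 rfl
      simp only [g, Equiv.trans_apply, this]
      change r' (ψ.symm (ψ e)) = r' e
      rw [Equiv.symm_apply_apply]
    have hg1 : ∀ e, g (P.partner (r e)) = Q.partner (r' e) := fun e => by
      have : θ.symm (P.partner (r e)) = (e, true) := θ.symm_apply_eq.2 rfl
      simp only [g, Equiv.trans_apply, this]
      change Q.partner (r' (ψ.symm (ψ e))) = _
      rw [Equiv.symm_apply_apply]
    have hall : ∀ d, (g d).1 = φ d.1 ∧ Q.partner (g d) = g (P.partner d) := by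
      intro d
      obtain ⟨⟨e, _ | _⟩, rfl⟩ := θ.surjective d
      · change (g (r e)).1 = φ (r e).1 ∧ Q.partner (g (r e)) = g (P.partner (r e))
        rw [hg0, hg1]
        exact ⟨h1 e, rfl⟩
      · change (g (P.partner (r e))).1 = φ (P.partner (r e)).1 ∧
          Q.partner (g (P.partner (r e))) = g (P.partner (P.partner (r e)))
        rw [P.partner_partner, hg0, hg1, Q.partner_partner]
        exact ⟨h2 e, rfl⟩
    exact ⟨⟨g, mem_dotSymmetry_of_cross g φ fun d => (hall d).1⟩,
      (smul_eq_iff _ _ _).2 fun d => (hall d).2⟩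
  · rintro ⟨g, rfl⟩
    exact graph_smul_isomorphic g P

theorem graph_connected_iff (P : PairingScheme v) :
    P.graph.Connected ↔ (equivPairing v P).Conn Sigma.fst := by
  have : (fun a b : Cross v => ∃ e : P.graph.E, P.graph.ends e = s(a, b)) =
      (equivPairing v P).Joined Sigma.fst := by
    funext a b
    apply propext
    constructor
    · rintro ⟨⟨p, d, rfl⟩, he⟩
      change Sym2.map Sigma.fst s(d, P.partner d) = s(a, b) at he
      rw [Sym2.map_mk, Sym2.eq_iff] at he
      rcases he with he | he
      · exact ⟨d, he⟩
      · exact ⟨P.partner d, he.2, by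
          change (P.partner (P.partner d)).1 = b
          rw [P.partner_partner, he.1]⟩
    · rintro ⟨d, rfl, rfl⟩
      exact ⟨⟨s(d, P.partner d), d, rfl⟩, rfl⟩
  unfold MultiGraph.Connected Pairing.Conn
  change _ ∧ (∀ x y : Cross v, Relation.ReflTransGen
    (fun a b : Cross v => ∃ e : P.graph.E, P.graph.ends e = s(a, b)) x y) ↔ _
  rw [this]
  rfl

end PairingScheme

/-! ### Sums over isomorphism classes of graphs -/

theorem exists_coeff_graphTerm {N : ℕ} (Γ : MultiGraph) (hΓ : Γ.DegreesIn N) (n : Fin N →₀ ℕ)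
    (h : Γ.vertexCount N = n) : ∃ P : PairingScheme n, P.graph.Isomorphic Γ ∧
      MvPowerSeries.coeff n (graphTerm Γ hΓ) = 1 / (Nat.card P.isotropy : ℚ) := by
  obtain rfl : n = Finsupp.equivFunOnFinite.symm (Γ.vertexCount N) := by
    rw [h]; exact (Finsupp.equivFunOnFinite.symm_apply_apply n).symm
  refine ⟨Γ.pairingScheme hΓ, Classical.choose_spec (exists_pairingScheme Γ hΓ), ?_⟩
  rw [graphTerm, MvPowerSeries.coeff_monomial_same]
  rfl

theorem coeff_graphTerm_eq_zero {N : ℕ} (Γ : MultiGraph) (hΓ : Γ.DegreesIn N) (n : Fin N →₀ ℕ)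
    (h : Γ.vertexCount N ≠ n) : MvPowerSeries.coeff n (graphTerm Γ hΓ) = 0 := by
  classical
  rw [graphTerm, MvPowerSeries.coeff_monomial, if_neg]
  rintro rfl
  exact h rfl

theorem GraphClass.rep_isomorphic (q : GraphClass) (Γ : MultiGraph) :
    q = (Quotient.mk _ Γ : GraphClass) ↔ q.rep.Isomorphic Γ := by
  rw [← Quotient.out_eq q, Quotient.eq, Quotient.out_eq]
  rfl

/-- The sum of `graphTerm` over the isomorphism classes of graphs with a given property counts the
pairing schemes with that property. -/
theorem hasFormalSum_graphTerm {N : ℕ} (K : MultiGraph → Prop)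
    (hK : ∀ Γ Δ : MultiGraph, Γ.Isomorphic Δ → K Γ → K Δ) {ι : Type*} (r : ι → GraphClass)
    (hinj : Function.Injective r) (hdeg : ∀ i, (r i).rep.DegreesIn N) (hKr : ∀ i, K (r i).rep)
    (hsurj : ∀ q : GraphClass, q.rep.DegreesIn N → K q.rep → ∃ i, r i = q)
    (F : MvPowerSeries (Fin N) ℚ)
    (hF : ∀ v : Fin N →₀ ℕ, MvPowerSeries.coeff v F =
      (Nat.card {P : PairingScheme v // K P.graph} : ℚ) / symCount v) :
    HasFormalSum (fun i => graphTerm (r i).rep (hdeg i)) F := by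
  classical
  intro n
  let X := {P : PairingScheme n // K P.graph}
  have : Fintype X := Fintype.ofFinite X
  -- The resulting map `f` sends a scheme to the class of its graph. Its nonempty fibres are the
  -- orbits, and they partition the schemes being counted.
  have hf : ∀ P : X, ∃ i, (r i).rep.Isomorphic P.1.graph := by
    intro P
    have h1 := (GraphClass.rep_isomorphic (Quotient.mk _ P.1.graph) P.1.graph).1 rfl
    obtain ⟨i, hi⟩ := hsurj (Quotient.mk _ P.1.graph) (h1.symm.degreesIn P.1.graph_degreesIn)
      (hK _ _ h1.symm P.2)
    exact ⟨i, by rw [hi]; exact h1⟩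
  choose f hf using hf
  have hf_iff : ∀ (P : X) i, f P = i ↔ (r i).rep.Isomorphic P.1.graph := by
    intro P i
    constructor
    · rintro rfl
      exact hf P
    · intro h
      apply hinj
      rw [(GraphClass.rep_isomorphic _ _).2 (hf P), (GraphClass.rep_isomorphic _ _).2 h]
  have hvc : ∀ i, MvPowerSeries.coeff n (graphTerm (r i).rep (hdeg i)) ≠ 0 →
      (r i).rep.vertexCount N = n := fun i hi => by
    by_contra h
    exact hi (coeff_graphTerm_eq_zero _ _ _ h)
  -- If the vertex counts match, `1 / |Aut|` equals orbit size over group order, and the orbit is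
  -- the fibre of `f`; otherwise both sides vanish.
  have hterm : ∀ i, MvPowerSeries.coeff n (graphTerm (r i).rep (hdeg i)) =
      ((Finset.univ.filter fun P : X => f P = i).card : ℚ) / symCount n := by
    intro i
    by_cases h : (r i).rep.vertexCount N = n
    · obtain ⟨P, hP, hc⟩ := exists_coeff_graphTerm _ (hdeg i) n h
      have h1 := P.card_orbit_mul_card_isotropy
      have h2 : Nat.card (MulAction.orbit (dotSymmetry n) P) =
          (Finset.univ.filter fun P : X => f P = i).card := by
        rw [← Fintype.card_subtype, ← Nat.card_eq_fintype_card]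
        have key : ∀ Q : PairingScheme n, Q ∈ MulAction.orbit (dotSymmetry n) P ↔
            (r i).rep.Isomorphic Q.graph := fun Q => by
          rw [← P.graph_isomorphic_iff]
          exact ⟨hP.symm.trans, hP.trans⟩
        refine Nat.card_congr
          { toFun := fun Q => ⟨⟨Q.1, hK _ _ ((key _).1 Q.2) (hKr i)⟩,
              (hf_iff _ _).2 ((key _).1 Q.2)⟩
            invFun := fun Q => ⟨Q.1.1, (key _).2 ((hf_iff _ _).1 Q.2)⟩
            left_inv := fun _ => rfl
            right_inv := fun _ => rfl }
      rw [hc, ← h2, ← card_dotSymmetry, ← h1]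
      have h3 : (Nat.card (MulAction.orbit (dotSymmetry n) P) : ℚ) ≠ 0 := by
        have : 0 < Nat.card (dotSymmetry n) := by rw [card_dotSymmetry]; exact symCount_pos _
        rw [← h1] at this
        exact_mod_cast (Nat.pos_of_mul_pos_right this).ne'
      push_cast
      rw [div_mul_cancel_left₀ h3, one_div]
    · rw [coeff_graphTerm_eq_zero _ _ _ h, Finset.filter_false_of_mem]
      · simp
      · rintro P - hPi
        exact h (((hf_iff P i).1 hPi).vertexCount_eq N |>.trans P.1.graph_vertexCount)
  have hfin : {i | MvPowerSeries.coeff n (graphTerm (r i).rep (hdeg i)) ≠ 0}.Finite := by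
    refine (Set.finite_range f).subset fun i hi => ?_
    by_contra hne
    refine hi ?_
    rw [hterm, Finset.filter_false_of_mem]
    · simp
    · rintro P - rfl
      exact hne ⟨P, rfl⟩
  refine ⟨hfin, ?_⟩
  rw [finsum_eq_sum_of_support_subset (s := hfin.toFinset) _ (fun i hi => by simpa using hi),
    Finset.sum_congr rfl fun i _ => hterm i, ← Finset.sum_div, hF, Nat.card_eq_fintype_card,
    ← Finset.card_univ, ← Nat.cast_sum]
  congr 2
  refine Finset.card_eq_sum_card_fiberwise fun P _ => ?_
  rw [Finset.mem_coe, Set.Finite.mem_toFinset, Set.mem_ofPred_eq, hterm]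
  have h1 : 0 < (Finset.univ.filter fun Q : X => f Q = f P).card :=
    Finset.card_pos.2 ⟨P, by simp⟩
  have h2 := symCount_pos (n : Fin N → ℕ)
  positivity

theorem hasFormalSum_graphs (N : ℕ) :
    HasFormalSum (fun q : {q : GraphClass // q.rep.DegreesIn N} => graphTerm q.1.rep q.2)
      (pairingSeries N) := by
  refine hasFormalSum_graphTerm (fun _ => True) (fun _ _ _ _ => trivial) Subtype.val
    Subtype.val_injective (fun q => q.2) (fun _ => trivial) (fun q hq _ => ⟨⟨q, hq⟩, rfl⟩) _ ?_
  intro v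
  rw [coeff_pairingSeries, Nat.card_congr (Equiv.subtypeUnivEquiv fun _ => trivial),
    Nat.card_congr (PairingScheme.equivPairing v), card_pairing _ _ rfl, card_dot]

theorem hasFormalSum_connected_graphs (N : ℕ) :
    HasFormalSum (fun q : {q : GraphClass // q.rep.DegreesIn N ∧ q.rep.Connected} =>
      graphTerm q.1.rep q.2.1) (connSeries N) := by
  refine hasFormalSum_graphTerm MultiGraph.Connected (fun _ _ h => h.connected) Subtype.val
    Subtype.val_injective (fun q => q.2.1) (fun q => q.2.2)
    (fun q hq hc => ⟨⟨q, hq, hc⟩, rfl⟩) _ ?_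
  intro v
  rw [coeff_connSeries, connCount]
  congr 2
  exact (Nat.card_congr ((PairingScheme.equivPairing v).subtypeEquiv fun P =>
    P.graph_connected_iff)).symm

/-! ### Asymptotic expansions of Laplace-type integrals -/

/-- For `‖u‖ ≤ 1` this is the usual remainder bound. For `‖u‖ ≥ 1` every term is dominated by `‖u‖ ^
n`: the exponential contributes the constant `1` because `Re u ≤ 0`, and the polynomial contributes
`∑ 1 / k! ≤ e`. A bound without exponential growth needs only finite moments after integration. -/
theorem norm_exp_sub_sum_le {u : ℂ} (hu : u.re ≤ 0) (n : ℕ) :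
    ‖Complex.exp u - ∑ k ∈ Finset.range n, u ^ k / (k.factorial : ℂ)‖ ≤
      (1 + Real.exp 1) * ‖u‖ ^ n := by
  rcases le_total ‖u‖ 1 with h | h
  · refine (Complex.norm_exp_sub_sum_le_norm_mul_exp u n).trans ?_
    rw [mul_comm]
    gcongr
    have := Real.exp_le_exp.2 h
    linarith
  · have h1 : ‖Complex.exp u‖ ≤ 1 := by
      rw [Complex.norm_exp]
      exact Real.exp_le_one_iff.2 hu
    have h2 : ‖∑ k ∈ Finset.range n, u ^ k / (k.factorial : ℂ)‖ ≤ Real.exp 1 * ‖u‖ ^ n := by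
      calc ‖∑ k ∈ Finset.range n, u ^ k / (k.factorial : ℂ)‖
          ≤ ∑ k ∈ Finset.range n, ‖u ^ k / (k.factorial : ℂ)‖ := norm_sum_le _ _
        _ ≤ ∑ k ∈ Finset.range n, (1 ^ k / (k.factorial : ℝ)) * ‖u‖ ^ n := by
            refine Finset.sum_le_sum fun k hk => ?_
            rw [norm_div, norm_pow, Complex.norm_natCast, one_pow, one_div, div_eq_inv_mul]
            exact mul_le_mul_of_nonneg_left (pow_le_pow_right₀ h (Finset.mem_range.1 hk).le)
              (by positivity)
        _ = (∑ k ∈ Finset.range n, 1 ^ k / (k.factorial : ℝ)) * ‖u‖ ^ n :=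
            (Finset.sum_mul _ _ _).symm
        _ ≤ _ := by
            gcongr
            exact Real.sum_le_exp_of_nonneg zero_le_one n
    have h3 : 1 ≤ ‖u‖ ^ n := one_le_pow₀ h
    calc _ ≤ ‖Complex.exp u‖ + ‖∑ k ∈ Finset.range n, u ^ k / (k.factorial : ℂ)‖ := norm_sub_le _ _
      _ ≤ ‖u‖ ^ n + Real.exp 1 * ‖u‖ ^ n := add_le_add (h1.trans h3) h2
      _ = _ := by ring

section Laplace

variable {α : Type*} [MeasurableSpace α] {μ : Measure α} {g : α → ℂ} {y : α → ℝ}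

theorem norm_exp_mul_le_one {z : ℂ} (hz : z.re ≤ 0) {s : ℝ} (hs : 0 ≤ s) :
    ‖Complex.exp (z * s)‖ ≤ 1 := by
  rw [Complex.norm_exp, Complex.re_mul_ofReal]
  exact Real.exp_le_one_iff.2 (mul_nonpos_of_nonpos_of_nonneg hz hs)

theorem aestronglyMeasurable_exp_mul (hy : Measurable y) (z : ℂ) :
    AEStronglyMeasurable (fun x => Complex.exp (z * y x)) μ := by
  have : Measurable fun x => Complex.exp (z * y x) :=
    Complex.measurable_exp.comp ((Complex.measurable_ofReal.comp hy).const_mul z)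
  exact this.aestronglyMeasurable

theorem integrable_mul_exp (hy : Measurable y) (hy0 : ∀ x, 0 ≤ y x) {f : α → ℂ}
    (hf : Integrable f μ) {z : ℂ} (hz : z.re ≤ 0) :
    Integrable (fun x => f x * Complex.exp (z * y x)) μ := by
  refine hf.mono (hf.aestronglyMeasurable.mul (aestronglyMeasurable_exp_mul hy z))
    (Eventually.of_forall fun x => ?_)
  rw [norm_mul]
  exact mul_le_of_le_one_right (norm_nonneg _) (norm_exp_mul_le_one hz (hy0 x))

theorem differentiableAt_integral_mul_exp (hy : Measurable y) (hy0 : ∀ x, 0 ≤ y x)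
    (hg : ∀ k : ℕ, Integrable (fun x => g x * (y x : ℂ) ^ k) μ) {z : ℂ} (hz : z.re < 0) :
    DifferentiableAt ℂ (fun z => ∫ x, g x * Complex.exp (z * y x) ∂μ) z := by
  have hg0 : Integrable g μ := by simpa using hg 0
  have hg1 : Integrable (fun x => g x * (y x : ℂ)) μ := by simpa using hg 1
  have hopen : {w : ℂ | w.re < 0} ∈ 𝓝 z :=
    (isOpen_lt Complex.continuous_re continuous_const).mem_nhds hz
  refine (hasDerivAt_integral_of_dominated_loc_of_deriv_le
    (F' := fun z x => g x * (y x : ℂ) * Complex.exp (z * y x))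
    (bound := fun x => ‖g x * (y x : ℂ)‖) hopen ?_ ?_ ?_ ?_ hg1.norm ?_).2.differentiableAt
  · exact Eventually.of_forall fun w =>
      hg0.aestronglyMeasurable.mul (aestronglyMeasurable_exp_mul hy w)
  · exact integrable_mul_exp hy hy0 hg0 hz.le
  · exact hg1.aestronglyMeasurable.mul (aestronglyMeasurable_exp_mul hy z)
  · refine Eventually.of_forall fun x w hw => ?_
    rw [norm_mul]
    exact mul_le_of_le_one_right (norm_nonneg _) (norm_exp_mul_le_one (le_of_lt hw) (hy0 x))
  · refine Eventually.of_forall fun x w _ => ?_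
    have := (((hasDerivAt_id w).mul_const (y x : ℂ)).cexp).const_mul (g x)
    refine this.congr_deriv ?_
    simp only [id]
    ring

theorem norm_integral_mul_exp_sub_le (hy : Measurable y) (hy0 : ∀ x, 0 ≤ y x)
    (hg : ∀ k : ℕ, Integrable (fun x => g x * (y x : ℂ) ^ k) μ) {z : ℂ} (hz : z.re ≤ 0) (n : ℕ) :
    ‖(∫ x, g x * Complex.exp (z * y x) ∂μ) - ∑ k ∈ Finset.range n,
        ((∫ x, g x * (y x : ℂ) ^ k ∂μ) / (k.factorial : ℂ)) * z ^ k‖ ≤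
      ((1 + Real.exp 1) * ∫ x, ‖g x * (y x : ℂ) ^ n‖ ∂μ) * ‖z‖ ^ n := by
  have hg0 : Integrable g μ := by simpa using hg 0
  have h1 : ∀ k : ℕ, ((∫ x, g x * (y x : ℂ) ^ k ∂μ) / (k.factorial : ℂ)) * z ^ k =
      ∫ x, g x * ((z * y x) ^ k / (k.factorial : ℂ)) ∂μ := fun k => by
    rw [div_mul_eq_mul_div, mul_div_assoc, ← integral_mul_const]
    congr 1
    funext x
    rw [mul_pow]
    ring
  have h2 : ∀ k : ℕ, Integrable (fun x => g x * ((z * y x) ^ k / (k.factorial : ℂ))) μ :=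
      fun k => by
    refine ((hg k).mul_const (z ^ k / (k.factorial : ℂ))).congr (Eventually.of_forall fun x => ?_)
    simp only [mul_pow]
    ring
  rw [Finset.sum_congr rfl fun k _ => h1 k, ← integral_finsetSum _ fun k _ => h2 k,
    ← integral_sub (integrable_mul_exp hy hy0 hg0 hz) (integrable_finsetSum _ fun k _ => h2 k),
    ← integral_const_mul, ← integral_mul_const]
  refine norm_integral_le_of_norm_le (((hg n).norm.const_mul _).mul_const _)
    (Eventually.of_forall fun x => ?_)
  rw [← Finset.mul_sum, ← mul_sub, norm_mul]
  have h3 : (z * y x).re ≤ 0 := by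
    rw [Complex.re_mul_ofReal]
    exact mul_nonpos_of_nonpos_of_nonneg hz (hy0 x)
  calc ‖g x‖ * _ ≤ ‖g x‖ * ((1 + Real.exp 1) * ‖z * y x‖ ^ n) := by
        gcongr
        exact norm_exp_sub_sum_le h3 n
    _ = _ := by
        rw [norm_mul, norm_mul, norm_pow, mul_pow]
        ring

/-- Laplace-type integrals have asymptotic expansions in the left half-plane. -/
theorem isAsymptoticExpansion_integral_mul_exp (hy : Measurable y) (hy0 : ∀ x, 0 ≤ y x)
    (hg : ∀ k : ℕ, Integrable (fun x => g x * (y x : ℂ) ^ k) μ) {Ω : Set ℂ}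
    (hΩ : ∀ z ∈ Ω, z.re < 0) :
    IsAsymptoticExpansion Ω (fun z => ∫ x, g x * Complex.exp (z * y x) ∂μ)
      (PowerSeries.mk fun k => (∫ x, g x * (y x : ℂ) ^ k ∂μ) / (k.factorial : ℂ)) := by
  refine ⟨fun z hz => (differentiableAt_integral_mul_exp
    hy hy0 hg (hΩ z hz)).differentiableWithinAt,
    fun M => ?_⟩
  simp only [PowerSeries.coeff_mk]
  set h : ℂ → ℂ := fun z => ∫ x, g x * Complex.exp (z * y x) ∂μ
  set a : ℕ → ℂ := fun k => (∫ x, g x * (y x : ℂ) ^ k ∂μ) / (k.factorial : ℂ)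
  -- The remainder is taken at order `M + 2`: after division by `z ^ (M + 1)` and subtraction of the
  -- next coefficient, an error `O(‖z‖)` remains.
  set C : ℝ := (1 + Real.exp 1) * ∫ x, ‖g x * (y x : ℂ) ^ (M + 2)‖ ∂μ
  rw [tendsto_iff_norm_sub_tendsto_zero]
  have hlim : Tendsto (fun z : ℂ => C * ‖z‖) (𝓝[Ω] 0) (𝓝 0) := by
    have : Tendsto (fun z : ℂ => C * ‖z‖) (𝓝 0) (𝓝 (C * ‖(0 : ℂ)‖)) :=
      (continuous_const.mul continuous_norm).tendsto 0
    rw [norm_zero, mul_zero] at this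
    exact this.mono_left nhdsWithin_le_nhds
  refine squeeze_zero' (Eventually.of_forall fun _ => norm_nonneg _) ?_ hlim
  filter_upwards [self_mem_nhdsWithin] with z hz
  have hz0 : z ≠ 0 := by
    rintro rfl
    simpa using hΩ 0 hz
  have h1 := norm_integral_mul_exp_sub_le hy hy0 hg (hΩ z hz).le (M + 2)
  have h2 : (h z - ∑ k ∈ Finset.range (M + 1), a k * z ^ k) / z ^ (M + 1) - a (M + 1) =
      (h z - ∑ k ∈ Finset.range (M + 2), a k * z ^ k) / z ^ (M + 1) := by
    rw [Finset.sum_range_succ _ (M + 1)]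
    field_simp
    ring
  rw [h2, norm_div, norm_pow, div_le_iff₀ (by positivity)]
  refine h1.trans (le_of_eq ?_)
  ring

end Laplace

theorem IsAsymptoticExpansion.congr {Ω : Set ℂ} {h h' : ℂ → ℂ} {a : PowerSeries ℂ}
    (H : IsAsymptoticExpansion Ω h a) (hh : ∀ z ∈ Ω, h z = h' z) :
    IsAsymptoticExpansion Ω h' a := by
  refine ⟨H.1.congr fun z hz => (hh z hz).symm, fun M => (H.2 M).congr' ?_⟩
  filter_upwards [self_mem_nhdsWithin] with z hz
  rw [hh z hz]

/-- A function has at most one asymptotic expansion. -/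
theorem IsAsymptoticExpansion.unique {Ω : Set ℂ} {h : ℂ → ℂ} {a b : PowerSeries ℂ}
    [(𝓝[Ω] (0 : ℂ)).NeBot] (h0 : (0 : ℂ) ∉ Ω) (ha : IsAsymptoticExpansion Ω h a)
    (hb : IsAsymptoticExpansion Ω h b) : a = b := by
  -- The definition gives limits only for the coefficients from index `1` on. The constant one is
  -- recovered from `M = 0`: the quotient converges, so its product with `z` tends to `0`.
  have hzero : ∀ {c : PowerSeries ℂ}, IsAsymptoticExpansion Ω h c →
      Tendsto h (𝓝[Ω] 0) (𝓝 (PowerSeries.coeff 0 c)) := by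
    intro c hc
    have h1 := hc.2 0
    have h2 : Tendsto (fun z : ℂ => z) (𝓝[Ω] 0) (𝓝 0) := nhdsWithin_le_nhds
    have h3 := (h1.mul h2).add_const (PowerSeries.coeff 0 c)
    simp only [mul_zero, zero_add] at h3
    refine h3.congr' ?_
    filter_upwards [self_mem_nhdsWithin] with z hz
    have hz0 : z ≠ 0 := fun h => h0 (h ▸ hz)
    simp
    field_simp
    ring
  ext n
  induction n using Nat.strong_induction_on with
  | _ n ih =>
    rcases n with _ | n
    · exact tendsto_nhds_unique (hzero ha) (hzero hb)
    · refine tendsto_nhds_unique (ha.2 n) ?_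
      refine (hb.2 n).congr fun z => ?_
      congr 2
      refine Finset.sum_congr rfl fun k hk => ?_
      rw [ih k (Finset.mem_range.1 hk)]

/-! ### Everywhere convergent multivariate power series -/

theorem _root_.HasSum.of_eq {ι : Type*} {f g : ι → ℂ} {a : ℂ} (h : HasSum f a)
    (hfg : ∀ x, f x = g x) : HasSum g a := by
  rwa [← funext hfg]

/-- Induction on the number of factors; absolute summability is carried along because multiplying
two series requires it. -/
theorem hasSum_prod_fin : ∀ (n : ℕ) (f : Fin n → ℕ → ℂ) (a : Fin n → ℂ),
    (∀ i, Summable fun k => ‖f i k‖) → (∀ i, HasSum (f i) (a i)) →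
    HasSum (fun w : Fin n → ℕ => ∏ i, f i (w i)) (∏ i, a i) ∧
      Summable fun w : Fin n → ℕ => ‖∏ i, f i (w i)‖
  | 0, f, a, _, _ => by
    simp only [Finset.univ_eq_empty, Finset.prod_empty]
    exact ⟨hasSum_unique _, (hasSum_unique _).summable⟩
  | n + 1, f, a, hf, ha => by
    obtain ⟨h1, h2⟩ := hasSum_prod_fin n (fun i => f i.succ) (fun i => a i.succ)
      (fun i => hf _) fun i => ha _
    rw [Fin.prod_univ_succ, ← (Fin.consEquiv fun _ : Fin (n + 1) => ℕ).hasSum_iff,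
      ← (Fin.consEquiv fun _ : Fin (n + 1) => ℕ).summable_iff]
    have h3 := Summable.mul_norm (hf 0) h2
    have h4 := (ha 0).mul h1 h3.of_norm
    constructor
    · refine h4.of_eq fun x => ?_
      simp [Fin.prod_univ_succ, Fin.consEquiv]
    · refine h3.congr ?_
      intro x
      simp [Fin.prod_univ_succ, Fin.consEquiv]

theorem hasSum_pow_div_factorial (a : ℂ) :
    HasSum (fun k : ℕ => a ^ k / (k.factorial : ℂ)) (Complex.exp a) := by
  rw [Complex.exp_eq_exp_ℂ]
  exact NormedSpace.expSeries_div_hasSum_exp a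

theorem hasSum_exp_sum_erase {N : ℕ} (ℓ : Fin N) (a : Fin N → ℂ) :
    HasSum (fun w : {w : Fin N →₀ ℕ // w ℓ = 0} => ∏ j, a j ^ w.1 j / ((w.1 j).factorial : ℂ))
      (Complex.exp (∑ j ∈ Finset.univ.erase ℓ, a j)) := by
  classical
  -- The series in position `ℓ` is replaced by `1, 0, 0, …`, which confines the product series to
  -- multi-indices with `w ℓ = 0`.
  let f : Fin N → ℕ → ℂ := fun j k =>
    if j = ℓ then (if k = 0 then 1 else 0) else a j ^ k / (k.factorial : ℂ)
  let b : Fin N → ℂ := fun j => if j = ℓ then 1 else Complex.exp (a j)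
  have hf : ∀ j, HasSum (f j) (b j) := by
    intro j
    by_cases hj : j = ℓ
    · simp only [f, b, hj, if_true]
      exact hasSum_ite_eq 0 1
    · simp only [f, b, hj, if_false]
      exact hasSum_pow_div_factorial (a j)
  have h1 := (hasSum_prod_fin N f b (fun j => (hf j).summable.norm) hf).1
  have h2 : ∏ j, b j = Complex.exp (∑ j ∈ Finset.univ.erase ℓ, a j) := by
    rw [Complex.exp_sum, ← Finset.mul_prod_erase _ _ (Finset.mem_univ ℓ)]
    simp only [b, if_true, one_mul]
    exact Finset.prod_congr rfl fun j hj => if_neg (Finset.ne_of_mem_erase hj)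
  rw [h2, ← (Finsupp.equivFunOnFinite (α := Fin N) (M := ℕ)).hasSum_iff] at h1
  rw [← hasSum_subtype_iff_of_support_subset (s := {w : Fin N →₀ ℕ | w ℓ = 0})] at h1
  · refine HasSum.of_eq (ι := {w : Fin N →₀ ℕ // w ℓ = 0}) h1 fun w => ?_
    change ∏ j, f j (w.1 j) = _
    refine Finset.prod_congr rfl fun j _ => ?_
    by_cases hj : j = ℓ
    · have : w.1 ℓ = 0 := w.2
      simp [f, hj, this]
    · simp [f, hj]
  · intro w hw
    by_contra hne
    refine hw (Finset.prod_eq_zero (Finset.mem_univ ℓ) ?_)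
    have : w ℓ ≠ 0 := hne
    simp [f, this]

theorem eq_zero_of_hasSum_pow {b : ℕ → ℂ} (h : ∀ s : ℂ, HasSum (fun n => b n * s ^ n) 0) (n : ℕ) :
    b n = 0 := by
  have h1 : HasFPowerSeriesAt (fun _ : ℂ => (0 : ℂ)) (FormalMultilinearSeries.ofScalars ℂ b) 0 := by
    rw [hasFPowerSeriesAt_iff]
    refine Eventually.of_forall fun s => ?_
    simpa [FormalMultilinearSeries.coeff_ofScalars, mul_comm] using h s
  have h2 := congrArg (fun p => FormalMultilinearSeries.coeff p n) h1.eq_zero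
  rw [FormalMultilinearSeries.coeff_ofScalars] at h2
  exact h2.trans (by simp [FormalMultilinearSeries.coeff])

/-- The coefficients of an everywhere convergent power series in finitely many variables are
determined by its sum. -/
theorem eq_zero_of_hasSum_prod_pow {σ : Type*} [Fintype σ] {ι : Type*} {w : ι → σ →₀ ℕ}
    (hw : Function.Injective w) {d : ι → ℂ}
    (h : ∀ τ : σ → ℂ, HasSum (fun i => d i * ∏ j, τ j ^ w i j) 0) (i : ι) : d i = 0 := by
  classical
  have hfin : ∀ n : ℕ, Finite {i : ι // (w i).degree = n} := fun n =>
    ((Finsupp.finite_of_degree_eq n).preimage hw.injOn).to_subtype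
  have hft : ∀ n : ℕ, Fintype {i : ι // (w i).degree = n} := fun n => Fintype.ofFinite _
  -- Along the line `s ↦ s * τ` the sum becomes a power series in `s` whose coefficients are the
  -- homogeneous parts at `τ`. Each part is a polynomial vanishing everywhere, hence zero.
  have key : ∀ (τ : σ → ℂ) (n : ℕ),
      ∑ i : {i : ι // (w i).degree = n}, d i * ∏ j, τ j ^ w i j = 0 := by
    intro τ
    apply eq_zero_of_hasSum_pow
    intro s
    have h1 := h fun j => s * τ j
    rw [← (Equiv.sigmaFiberEquiv fun i => (w i).degree).hasSum_iff] at h1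
    refine h1.sigma fun n => ?_
    rw [Finset.sum_mul]
    convert hasSum_fintype (fun k : {i : ι // (w i).degree = n} =>
      d k * (∏ j, τ j ^ w k j) * s ^ n) using 1
    funext k
    obtain ⟨k, rfl⟩ := k
    simp only [Function.comp_apply, Equiv.sigmaFiberEquiv_apply, mul_pow,
      Finset.prod_mul_distrib, Finset.prod_pow_eq_pow_sum, Finsupp.degree_eq_sum]
    ring
  let P : MvPolynomial σ ℂ :=
    ∑ k : {k : ι // (w k).degree = (w i).degree}, MvPolynomial.monomial (w k) (d k)
  have hP : P = 0 := by
    refine MvPolynomial.funext fun τ => ?_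
    rw [map_zero, map_sum, ← key τ (w i).degree]
    refine Finset.sum_congr rfl fun k _ => ?_
    rw [MvPolynomial.eval_monomial, Finsupp.prod_fintype _ _ fun _ => pow_zero _]
  have h2 := congrArg (MvPolynomial.coeff (w i)) hP
  rw [MvPolynomial.coeff_sum, MvPolynomial.coeff_zero,
    Finset.sum_eq_single (⟨i, rfl⟩ : {k : ι // (w k).degree = (w i).degree})] at h2
  · simpa using h2
  · intro k _ hk
    rw [MvPolynomial.coeff_monomial, if_neg]
    exact fun hne => hk (Subtype.ext (hw hne))
  · simp

/-! ### Gaussian moments -/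

/-- The standard Gaussian density. -/
def gaussWeight (x : ℝ) : ℝ := Real.exp (-x ^ 2 / 2) / Real.sqrt (2 * Real.pi)

theorem gaussWeight_nonneg (x : ℝ) : 0 ≤ gaussWeight x := by
  unfold gaussWeight; positivity

theorem continuous_gaussWeight : Continuous gaussWeight := by
  unfold gaussWeight; fun_prop

theorem integrable_pow_mul_exp (k : ℕ) :
    Integrable fun x : ℝ => x ^ k * Real.exp (-x ^ 2 / 2) := by
  have h := integrable_rpow_mul_exp_neg_mul_sq (b := 1 / 2) (by norm_num) (s := (k : ℝ))
    (by have : (0 : ℝ) ≤ k := k.cast_nonneg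
        linarith)
  refine h.congr (Eventually.of_forall fun x => ?_)
  simp only [Real.rpow_natCast]
  ring_nf

theorem integrable_pow_mul_gaussWeight (k : ℕ) :
    Integrable fun x : ℝ => x ^ k * gaussWeight x := by
  refine ((integrable_pow_mul_exp k).div_const (Real.sqrt (2 * Real.pi))).congr
    (Eventually.of_forall fun x => ?_)
  simp only [gaussWeight]
  ring

/-- Integration by parts, using that the derivative of the Gaussian weight is `-x` times the weight.
It yields the recursion of `pairingNumber`. -/
theorem integral_pow_add_two (k : ℕ) :
    ∫ x : ℝ, x ^ (k + 2) * gaussWeight x = (k + 1) * ∫ x : ℝ, x ^ k * gaussWeight x := by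
  have hG : ∀ x : ℝ, HasDerivAt gaussWeight (-x * gaussWeight x) x := fun x => by
    have h1 : HasDerivAt (fun x : ℝ => -x ^ 2 / 2) (-x) x := by
      refine (((hasDerivAt_pow 2 x).neg).div_const 2).congr_deriv ?_
      simp only [Nat.cast_ofNat, Nat.add_one_sub_one, pow_one]
      ring
    refine ((h1.exp).div_const (Real.sqrt (2 * Real.pi))).congr_deriv ?_
    simp only [gaussWeight]
    ring
  have h := integral_mul_deriv_eq_deriv_mul_of_integrable
    (u := fun x : ℝ => x ^ (k + 1)) (u' := fun x : ℝ => ((k : ℝ) + 1) * x ^ k)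
    (v := gaussWeight) (v' := fun x => -x * gaussWeight x)
    (fun x _ => by simpa using hasDerivAt_pow (k + 1) x) (fun x _ => hG x)
    ((integrable_pow_mul_gaussWeight (k + 2)).neg.congr (Eventually.of_forall fun x => by
      simp only [Pi.neg_apply, Pi.mul_apply]; ring))
    (((integrable_pow_mul_gaussWeight k).const_mul ((k : ℝ) + 1)).congr
      (Eventually.of_forall fun x => by simp only [Pi.mul_apply]; ring))
    (integrable_pow_mul_gaussWeight (k + 1))
  have h1 : ∀ x : ℝ, x ^ (k + 1) * (-x * gaussWeight x) = -(x ^ (k + 2) * gaussWeight x) :=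
    fun x => by ring
  simp only [h1, mul_assoc, integral_neg, integral_const_mul, neg_inj] at h
  exact h

theorem integral_gaussWeight : ∫ x : ℝ, gaussWeight x = 1 := by
  have h := integral_gaussian (1 / 2)
  have h1 : ∀ x : ℝ, gaussWeight x = Real.exp (-(1 / 2) * x ^ 2) / Real.sqrt (2 * Real.pi) := by
    intro x
    rw [gaussWeight]
    ring_nf
  simp only [h1]
  rw [integral_div, h]
  have : Real.pi / (1 / 2) = 2 * Real.pi := by ring
  rw [this, div_self (by positivity)]

/-- The moments of the standard Gaussian count pairings. -/
theorem integral_pow_mul_gaussWeight : ∀ k : ℕ,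
    ∫ x : ℝ, x ^ k * gaussWeight x = pairingNumber k
  | 0 => by simpa [pairingNumber] using integral_gaussWeight
  | 1 => by
    have h := integral_neg_eq_self (fun x : ℝ => x ^ 1 * gaussWeight x) volume
    have h1 : ∀ x : ℝ, (-x) ^ 1 * gaussWeight (-x) = -(x ^ 1 * gaussWeight x) := fun x => by
      simp [gaussWeight]
    simp only [h1, integral_neg] at h
    rw [pairingNumber, Nat.cast_zero]
    linarith
  | k + 2 => by
    rw [integral_pow_add_two, integral_pow_mul_gaussWeight k, pairingNumber]
    push_cast
    ring

/-! ### The integrand -/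

section Integrand

variable {N : ℕ}

/-- The scaled monomial `x ^ (j + 1) / (j + 1)!`. -/
def legMonomial (j : Fin N) (x : ℝ) : ℝ := x ^ ((j : ℕ) + 1) / ((j : ℕ) + 1).factorial

theorem continuous_legMonomial (j : Fin N) : Continuous (legMonomial j) := by
  unfold legMonomial; fun_prop

theorem integrand_eq (t : Fin N → ℂ) (x : ℝ) :
    integrand t x = (gaussWeight x : ℂ) * Complex.exp (∑ j, t j * (legMonomial j x : ℂ)) := by
  have : ∀ j : Fin N, t j / (Nat.factorial ((j : ℕ) + 1) : ℂ) * (x : ℂ) ^ ((j : ℕ) + 1) =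
      t j * (legMonomial j x : ℂ) := fun j => by
    simp only [legMonomial]
    push_cast
    ring
  rw [integrand, Finset.sum_congr rfl fun j _ => this j, gaussWeight]
  push_cast
  ring

theorem exists_mul_pow_le {k n : ℕ} (hk : k < n) {c R : ℝ} (hc : 0 < c) (hR : 0 ≤ R) :
    ∃ K : ℝ, ∀ r : ℝ, 0 ≤ r → R * r ^ k ≤ K + c * r ^ n := by
  -- Beyond `R / c` one factor of `r` absorbs the constant `R`; beyond `1` larger exponents give
  -- larger powers.
  set M := max 1 (R / c)
  have hM1 : 1 ≤ M := le_max_left _ _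
  have hM2 : R ≤ c * M := by
    rw [mul_comm, ← div_le_iff₀ hc]
    exact le_max_right _ _
  refine ⟨R * M ^ k, fun r hr => ?_⟩
  rcases le_total r M with h | h
  · have h1 : R * r ^ k ≤ R * M ^ k := by gcongr
    have h2 : 0 ≤ c * r ^ n := by positivity
    linarith
  · have h1 : r ^ (k + 1) ≤ r ^ n := pow_le_pow_right₀ (hM1.trans h) hk
    have h2 : R * r ^ k ≤ c * r * r ^ k := by
      refine mul_le_mul_of_nonneg_right (hM2.trans ?_) (by positivity)
      gcongr
    have h3 : c * r * r ^ k ≤ c * r ^ n := by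
      rw [mul_assoc, ← pow_succ']
      gcongr
    have h4 : 0 ≤ R * M ^ k := by positivity
    linarith

variable {ℓ : Fin N}

theorem legMonomial_nonneg_of_even (hE : Even ((ℓ : ℕ) + 1)) (x : ℝ) : 0 ≤ legMonomial ℓ x :=
  div_nonneg (hE.pow_nonneg x) (by positivity)

/-- For a coefficient of negative real part at the leading even power, the exponent is bounded
above, uniformly on bounded sets. -/
theorem exists_exponent_le (hE : Even ((ℓ : ℕ) + 1)) (hℓ : ∀ j : Fin N, j ≤ ℓ) {c R : ℝ}
    (hc : 0 < c) (hR : 0 ≤ R) : ∃ K : ℝ, ∀ (s : ℝ) (r : Fin N → ℝ), s ≤ -c → (∀ j, r j ≤ R) →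
      ∀ x : ℝ, s * legMonomial ℓ x +
        ∑ j ∈ Finset.univ.erase ℓ, r j * |legMonomial j x| ≤ K := by
  have hfac : (0 : ℝ) < ((ℓ : ℕ) + 1).factorial := by positivity
  -- The decay of the top term is divided into `N + 1` equal shares, enough to give one to each
  -- lower term.
  set c' : ℝ := c / ((ℓ : ℕ) + 1).factorial / (N + 1) with hc'
  have hc'0 : 0 < c' := by positivity
  have hK : ∀ j : Fin N, ∃ K : ℝ, j ≠ ℓ → ∀ x : ℝ, R * |legMonomial j x| ≤
      K + c' * |x| ^ ((ℓ : ℕ) + 1) := by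
    intro j
    by_cases hj : j = ℓ
    · exact ⟨0, fun h => (h hj).elim⟩
    have hlt : (j : ℕ) + 1 < (ℓ : ℕ) + 1 := by
      have := lt_of_le_of_ne (hℓ j) hj
      rw [Fin.lt_def] at this
      omega
    obtain ⟨K, hK⟩ := exists_mul_pow_le hlt hc'0 hR
    refine ⟨K, fun _ x => le_trans ?_ (hK |x| (abs_nonneg x))⟩
    gcongr
    rw [legMonomial, abs_div, abs_pow, Nat.abs_cast]
    refine div_le_self (by positivity) ?_
    exact_mod_cast Nat.factorial_pos _
  choose K hK using hK
  refine ⟨∑ j ∈ Finset.univ.erase ℓ, K j, fun s r hs hr x => ?_⟩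
  have h1 : s * legMonomial ℓ x ≤ -((N + 1) * c' * |x| ^ ((ℓ : ℕ) + 1)) := by
    have : (N + 1) * c' = c / ((ℓ : ℕ) + 1).factorial := by
      rw [hc']; field_simp
    rw [this, hE.pow_abs, div_mul_eq_mul_div, mul_div_assoc, ← neg_mul]
    exact mul_le_mul_of_nonneg_right hs (legMonomial_nonneg_of_even hE x)
  have h2 : ∑ j ∈ Finset.univ.erase ℓ, r j * |legMonomial j x| ≤
      ∑ j ∈ Finset.univ.erase ℓ, (K j + c' * |x| ^ ((ℓ : ℕ) + 1)) := by
    refine Finset.sum_le_sum fun j hj => ?_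
    exact (mul_le_mul_of_nonneg_right (hr j) (abs_nonneg _)).trans
      (hK j (Finset.ne_of_mem_erase hj) x)
  rw [Finset.sum_add_distrib, Finset.sum_const, nsmul_eq_mul] at h2
  have h3 : ((Finset.univ.erase ℓ).card : ℝ) ≤ N + 1 := by
    have := Finset.card_le_univ (Finset.univ.erase ℓ)
    rw [Fintype.card_fin] at this
    have : ((Finset.univ.erase ℓ).card : ℝ) ≤ N := by exact_mod_cast this
    linarith
  have h4 : ((Finset.univ.erase ℓ).card : ℝ) * (c' * |x| ^ ((ℓ : ℕ) + 1)) ≤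
      (N + 1) * (c' * |x| ^ ((ℓ : ℕ) + 1)) := by gcongr
  linarith

theorem re_sum_le (t : Fin N → ℂ) (x : ℝ) : (∑ j, t j * (legMonomial j x : ℂ)).re ≤
    (t ℓ).re * legMonomial ℓ x + ∑ j ∈ Finset.univ.erase ℓ, ‖t j‖ * |legMonomial j x| := by
  rw [← Finset.add_sum_erase _ _ (Finset.mem_univ ℓ), Complex.add_re, Complex.re_mul_ofReal,
    Complex.re_sum]
  gcongr with j
  rw [Complex.re_mul_ofReal]
  refine (le_abs_self _).trans ?_
  rw [abs_mul]
  gcongr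
  exact Complex.abs_re_le_norm _

theorem exists_norm_exp_le (hE : Even ((ℓ : ℕ) + 1)) (hℓ : ∀ j : Fin N, j ≤ ℓ) {c R : ℝ}
    (hc : 0 < c) (hR : 0 ≤ R) : ∃ K : ℝ, ∀ t : Fin N → ℂ, (t ℓ).re ≤ -c → (∀ j, ‖t j‖ ≤ R) →
      ∀ x : ℝ, ‖Complex.exp (∑ j, t j * (legMonomial j x : ℂ))‖ ≤ K := by
  obtain ⟨K, hK⟩ := exists_exponent_le hE hℓ hc hR
  refine ⟨Real.exp K, fun t ht hR x => ?_⟩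
  rw [Complex.norm_exp]
  exact Real.exp_le_exp.2 ((re_sum_le t x).trans (hK _ _ ht hR x))

theorem continuous_exp_sum (t : Fin N → ℂ) :
    Continuous fun x : ℝ => Complex.exp (∑ j, t j * (legMonomial j x : ℂ)) := by
  have := fun j : Fin N => continuous_legMonomial j
  fun_prop

theorem continuous_integrand (t : Fin N → ℂ) : Continuous (integrand t) := by
  have h : integrand t = fun x => (gaussWeight x : ℂ) *
    Complex.exp (∑ j, t j * (legMonomial j x : ℂ)) := funext (integrand_eq t)
  rw [h]
  exact (Complex.continuous_ofReal.comp continuous_gaussWeight).mul (continuous_exp_sum t)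

theorem integrable_gaussWeight_mul_prod (n : Fin N → ℕ) :
    Integrable fun x => gaussWeight x * ∏ j, legMonomial j x ^ n j := by
  refine ((integrable_pow_mul_gaussWeight (dotCount n)).const_mul
    (∏ j : Fin N, ((((j : ℕ) + 1).factorial : ℝ) ^ n j)⁻¹)).congr (Eventually.of_forall fun x => ?_)
  simp only [legMonomial, div_pow, Finset.prod_div_distrib, dotCount, ← pow_mul,
    Finset.prod_pow_eq_pow_sum, Finset.prod_inv_distrib, mul_comm]
  ring

/-- The product is a constant times `x ^ dotCount n`, so the integral is a Gaussian moment. The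
factor `∏ (n j)!` is the one that Taylor coefficients cancel. -/
theorem integral_gaussWeight_mul_prod (n : Fin N → ℕ) :
    ∫ x, gaussWeight x * ∏ j, legMonomial j x ^ n j =
      (∏ j, ((n j).factorial : ℝ)) * (pairingNumber (dotCount n) / symCount n) := by
  have h : ∀ x : ℝ, gaussWeight x * ∏ j, legMonomial j x ^ n j =
      (∏ j : Fin N, ((((j : ℕ) + 1).factorial : ℝ) ^ n j)⁻¹) *
        (x ^ dotCount n * gaussWeight x) := fun x => by
    simp only [legMonomial, div_pow, Finset.prod_div_distrib, dotCount, ← pow_mul,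
      Finset.prod_pow_eq_pow_sum, Finset.prod_inv_distrib, mul_comm]
    ring
  simp only [h, integral_const_mul, integral_pow_mul_gaussWeight, symCount]
  push_cast
  rw [Finset.prod_mul_distrib, Finset.prod_inv_distrib]
  have h1 : ∏ j, ((n j).factorial : ℝ) ≠ 0 :=
    Finset.prod_ne_zero_iff.2 fun j _ => by positivity
  have h2 : ∏ j : Fin N, (((j : ℕ) + 1).factorial : ℝ) ^ n j ≠ 0 :=
    Finset.prod_ne_zero_iff.2 fun j _ => by positivity
  field_simp

theorem integrable_gaussWeight : Integrable gaussWeight := by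
  simpa using integrable_pow_mul_gaussWeight 0

theorem integrable_integrand (hE : Even ((ℓ : ℕ) + 1)) (hℓ : ∀ j : Fin N, j ≤ ℓ) {t : Fin N → ℂ}
    (ht : (t ℓ).re < 0) : Integrable (integrand t) := by
  obtain ⟨K, hK⟩ := exists_norm_exp_le hE hℓ (c := -(t ℓ).re) (R := ‖t‖) (by linarith)
    (norm_nonneg _)
  refine (integrable_gaussWeight.mul_const K).mono' (continuous_integrand t).aestronglyMeasurable
    (Eventually.of_forall fun x => ?_)
  rw [integrand_eq, norm_mul, Complex.norm_real, Real.norm_of_nonneg (gaussWeight_nonneg x)]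
  exact mul_le_mul_of_nonneg_left (hK t (by simp) (norm_le_pi_norm t) x) (gaussWeight_nonneg x)

/-- The exponent of the integrand as a linear form in the variables. -/
def exponentForm (x : ℝ) : (Fin N → ℂ) →L[ℂ] ℂ :=
  ∑ j, (legMonomial j x : ℂ) • ContinuousLinearMap.proj (R := ℂ) (φ := fun _ : Fin N => ℂ) j

theorem exponentForm_apply (x : ℝ) (t : Fin N → ℂ) :
    exponentForm x t = ∑ j, t j * (legMonomial j x : ℂ) := by
  simp [exponentForm, mul_comm]

theorem continuous_exponentForm : Continuous (exponentForm (N := N)) := by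
  unfold exponentForm
  have := fun j : Fin N => continuous_legMonomial j
  fun_prop

theorem norm_exponentForm_le (x : ℝ) :
    ‖exponentForm (N := N) x‖ ≤ ∑ j : Fin N, |legMonomial j x| := by
  refine ContinuousLinearMap.opNorm_le_bound _ (Finset.sum_nonneg fun _ _ => abs_nonneg _)
    fun t => ?_
  rw [exponentForm_apply, Finset.sum_mul]
  refine (norm_sum_le _ _).trans (Finset.sum_le_sum fun j _ => ?_)
  rw [norm_mul, Complex.norm_real, mul_comm, Real.norm_eq_abs]
  exact mul_le_mul_of_nonneg_left (norm_le_pi_norm t j) (abs_nonneg _)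

theorem integrable_gaussWeight_mul_abs (j : Fin N) :
    Integrable fun x => gaussWeight x * |legMonomial j x| := by
  classical
  refine (integrable_gaussWeight_mul_prod (Pi.single j 1)).abs.congr
    (Eventually.of_forall fun x => ?_)
  have : ∏ i, legMonomial i x ^ (Pi.single j 1 : Fin N → ℕ) i = legMonomial j x := by
    rw [Finset.prod_eq_single j]
    · simp
    · intro i _ hi
      simp [hi]
    · simp
  simp only [this, abs_mul, abs_of_nonneg (gaussWeight_nonneg x)]

theorem differentiableAt_partitionFunction (hE : Even ((ℓ : ℕ) + 1)) (hℓ : ∀ j : Fin N, j ≤ ℓ)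
    {t : Fin N → ℂ} (ht : (t ℓ).re < 0) : DifferentiableAt ℂ partitionFunction t := by
  -- On the ball of this radius around `t` the real part at `ℓ` stays at most `-c`, so a single
  -- bound `K` serves for differentiating under the integral.
  set c : ℝ := -(t ℓ).re / 2 with hc
  have hc0 : 0 < c := by linarith
  obtain ⟨K, hK⟩ := exists_norm_exp_le hE hℓ hc0 (R := ‖t‖ + c) (by positivity)
  refine (hasFDerivAt_integral_of_dominated_of_fderiv_le (s := Metric.ball t c)
    (F := fun t x => integrand t x)
    (F' := fun t x => ((gaussWeight x : ℂ) * Complex.exp (exponentForm x t)) • exponentForm x)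
    (bound := fun x => K * ∑ j : Fin N, gaussWeight x * |legMonomial j x|)
    (Metric.ball_mem_nhds t hc0) ?_ (integrable_integrand hE hℓ ht) ?_ ?_ ?_ ?_).differentiableAt
  · exact Eventually.of_forall fun s => (continuous_integrand s).aestronglyMeasurable
  · refine Continuous.aestronglyMeasurable ?_
    have h1 := continuous_exponentForm (N := N)
    have h2 := continuous_gaussWeight
    fun_prop
  · refine Eventually.of_forall fun x s hs => ?_
    have hs' : ‖s - t‖ < c := by rwa [← dist_eq_norm]
    have h1 : (s ℓ).re ≤ -c := by
      have h2 : ‖(s - t) ℓ‖ ≤ ‖s - t‖ := norm_le_pi_norm _ _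
      have h3 : |((s - t) ℓ).re| ≤ ‖(s - t) ℓ‖ := Complex.abs_re_le_norm _
      have h4 := le_abs_self ((s - t) ℓ).re
      rw [Pi.sub_apply, Complex.sub_re] at h4
      rw [Pi.sub_apply, Complex.sub_re] at h3
      rw [Pi.sub_apply] at h2
      linarith
    have h2 : ∀ j, ‖s j‖ ≤ ‖t‖ + c := fun j => by
      have h3 : ‖s‖ ≤ ‖t‖ + ‖s - t‖ := by
        simpa using norm_add_le t (s - t)
      exact (norm_le_pi_norm s j).trans (by linarith)
    rw [norm_smul, norm_mul, Complex.norm_real, Real.norm_of_nonneg (gaussWeight_nonneg x),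
      exponentForm_apply, ← Finset.mul_sum]
    have h3 := hK s h1 h2 x
    calc _ ≤ (gaussWeight x * K) * ∑ j : Fin N, |legMonomial j x| := by
          refine mul_le_mul (mul_le_mul_of_nonneg_left h3 (gaussWeight_nonneg x))
            (norm_exponentForm_le x) (norm_nonneg _) ?_
          exact mul_nonneg (gaussWeight_nonneg x) ((norm_nonneg _).trans h3)
      _ = _ := by ring
  · exact (integrable_finsetSum _ fun j _ => integrable_gaussWeight_mul_abs j).const_mul K
  · refine Eventually.of_forall fun x s _ => ?_
    have h1 : (fun s : Fin N → ℂ => integrand s x) =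
        fun s => (gaussWeight x : ℂ) * Complex.exp (exponentForm x s) := funext fun s => by
      rw [integrand_eq, exponentForm_apply]
    rw [h1]
    refine (((exponentForm x).hasFDerivAt (x := s)).cexp.const_mul
      (gaussWeight x : ℂ)).congr_fderiv ?_
    rw [smul_smul]

/-- The Gaussian weight times the Taylor coefficient of the exponential at `t ^ w`. -/
def taylorWeight (w : Fin N → ℕ) (x : ℝ) : ℂ :=
  (gaussWeight x : ℂ) * ∏ j, (legMonomial j x : ℂ) ^ w j / ((w j).factorial : ℂ)

/-- The Taylor coefficients of the partition function in the variables other than `t ℓ`. -/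
def taylorCoeff (ℓ : Fin N) (w : Fin N → ℕ) (z : ℂ) : ℂ :=
  ∫ x, taylorWeight w x * Complex.exp (z * (legMonomial ℓ x : ℂ))

/-- As `w` does not involve `ℓ`, the extra power only changes the exponent at `ℓ` to `k`. The factor
`k!` makes up for the missing factorial there and cancels against the asymptotic coefficient. -/
theorem taylorWeight_mul_pow (w : Fin N →₀ ℕ) (hw : w ℓ = 0) (k : ℕ) (x : ℝ) :
    taylorWeight w x * (legMonomial ℓ x : ℂ) ^ k =
      (k.factorial / ∏ j, (((w + Finsupp.single ℓ k) j).factorial : ℂ)) *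
        ((gaussWeight x * ∏ j, legMonomial j x ^ (w + Finsupp.single ℓ k) j : ℝ) : ℂ) := by
  have hk : (k.factorial : ℂ) ≠ 0 := by exact_mod_cast k.factorial_ne_zero
  have hne : ∀ j : Fin N, j ∈ Finset.univ.erase ℓ → (w + Finsupp.single ℓ k) j = w j :=
    fun j hj => by
      rw [Finsupp.add_apply, Finsupp.single_eq_of_ne (Finset.ne_of_mem_erase hj), add_zero]
  have hℓk : (w + Finsupp.single ℓ k) ℓ = k := by simp [hw]
  generalize w + Finsupp.single ℓ k = u at hne hℓk
  push_cast
  rw [taylorWeight, Finset.prod_div_distrib,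
    ← Finset.mul_prod_erase _ (fun j => (legMonomial j x : ℂ) ^ w j) (Finset.mem_univ ℓ),
    ← Finset.mul_prod_erase _ (fun j => ((w j).factorial : ℂ)) (Finset.mem_univ ℓ),
    ← Finset.mul_prod_erase _ (fun j => (legMonomial j x : ℂ) ^ u j) (Finset.mem_univ ℓ),
    ← Finset.mul_prod_erase _ (fun j => ((u j).factorial : ℂ)) (Finset.mem_univ ℓ),
    Finset.prod_congr (f := fun j => (legMonomial j x : ℂ) ^ u j) rfl
      fun j hj => by rw [hne j hj],
    Finset.prod_congr (f := fun j => ((u j).factorial : ℂ)) rfl fun j hj => by rw [hne j hj],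
    hℓk, hw]
  have h2 : ∏ j ∈ Finset.univ.erase ℓ, ((w j).factorial : ℂ) ≠ 0 :=
    Finset.prod_ne_zero_iff.2 fun j _ => by exact_mod_cast (w j).factorial_ne_zero
  field_simp
  simp

theorem integrable_taylorWeight_mul_pow (w : Fin N →₀ ℕ) (hw : w ℓ = 0) (k : ℕ) :
    Integrable fun x => taylorWeight w x * (legMonomial ℓ x : ℂ) ^ k := by
  simp only [taylorWeight_mul_pow w hw k]
  exact (integrable_gaussWeight_mul_prod _).ofReal.const_mul _

theorem integral_taylorWeight_mul_pow (w : Fin N →₀ ℕ) (hw : w ℓ = 0) (k : ℕ) :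
    (∫ x, taylorWeight w x * (legMonomial ℓ x : ℂ) ^ k) / (k.factorial : ℂ) =
      MvPowerSeries.coeff (w + Finsupp.single ℓ k)
        (MvPowerSeries.map (algebraMap ℚ ℂ) (pairingSeries N)) := by
  have hk : (k.factorial : ℂ) ≠ 0 := by exact_mod_cast k.factorial_ne_zero
  simp only [taylorWeight_mul_pow w hw k, integral_const_mul]
  rw [integral_complex_ofReal, integral_gaussWeight_mul_prod, MvPowerSeries.coeff_map,
    coeff_pairingSeries]
  generalize w + Finsupp.single ℓ k = u
  have h2 : ∏ j, ((u j).factorial : ℂ) ≠ 0 :=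
    Finset.prod_ne_zero_iff.2 fun j _ => by exact_mod_cast Nat.factorial_ne_zero _
  simp only [eq_ratCast]
  push_cast
  field_simp

theorem isAsymptoticExpansion_taylorCoeff (hE : Even ((ℓ : ℕ) + 1)) {Ω : Set ℂ}
    (hΩ : ∀ z ∈ Ω, z.re < 0) (w : Fin N →₀ ℕ) (hw : w ℓ = 0) :
    IsAsymptoticExpansion Ω (taylorCoeff ℓ w)
      (PowerSeries.mk fun k => MvPowerSeries.coeff (w + Finsupp.single ℓ k)
        (MvPowerSeries.map (algebraMap ℚ ℂ) (pairingSeries N))) := by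
  simp only [← integral_taylorWeight_mul_pow w hw]
  exact isAsymptoticExpansion_integral_mul_exp (continuous_legMonomial ℓ).measurable
    (legMonomial_nonneg_of_even hE) (integrable_taylorWeight_mul_pow w hw) hΩ

/-- The exponential is expanded in the variables other than `t ℓ` and integrated term by term. The
norms of the terms sum to an exponential of the shape bounded by `exists_exponent_le`, so a multiple
of the Gaussian dominates. -/
theorem hasSum_taylorCoeff (hE : Even ((ℓ : ℕ) + 1)) (hℓ : ∀ j : Fin N, j ≤ ℓ) {t : Fin N → ℂ}
    (ht : (t ℓ).re < 0) : HasSum (fun w : {w : Fin N →₀ ℕ // w ℓ = 0} =>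
      taylorCoeff ℓ w (t ℓ) * ∏ j, t j ^ w.1 j) (partitionFunction t) := by
  let F : {w : Fin N →₀ ℕ // w ℓ = 0} → ℝ → ℂ := fun w x =>
    taylorWeight w.1 x * Complex.exp (t ℓ * (legMonomial ℓ x : ℂ)) * ∏ j, t j ^ w.1 j
  have hF : ∀ w x, F w x = (gaussWeight x : ℂ) * Complex.exp (t ℓ * (legMonomial ℓ x : ℂ)) *
      ∏ j, (t j * (legMonomial j x : ℂ)) ^ w.1 j / ((w.1 j).factorial : ℂ) := fun w x => by
    simp only [F, taylorWeight, Finset.prod_div_distrib, mul_pow, Finset.prod_mul_distrib]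
    ring
  have hnorm : ∀ w x, ‖F w x‖ = gaussWeight x * Real.exp ((t ℓ).re * legMonomial ℓ x) *
      ∏ j, (‖t j‖ * |legMonomial j x|) ^ w.1 j / ((w.1 j).factorial : ℝ) := fun w x => by
    rw [hF, norm_mul, norm_mul, Complex.norm_real, Real.norm_of_nonneg (gaussWeight_nonneg x),
      Complex.norm_exp, Complex.re_mul_ofReal, norm_prod]
    congr 1
    refine Finset.prod_congr rfl fun j _ => ?_
    rw [norm_div, norm_pow, norm_mul, Complex.norm_real, Complex.norm_natCast, Real.norm_eq_abs]
  have hsumnorm : ∀ x, HasSum (fun w => ‖F w x‖) (gaussWeight x *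
      Real.exp ((t ℓ).re * legMonomial ℓ x +
        ∑ j ∈ Finset.univ.erase ℓ, ‖t j‖ * |legMonomial j x|)) := fun x => by
    have h := hasSum_exp_sum_erase ℓ fun j => ((‖t j‖ * |legMonomial j x| : ℝ) : ℂ)
    have h' : HasSum (fun w : {w : Fin N →₀ ℕ // w ℓ = 0} =>
        ∏ j, (‖t j‖ * |legMonomial j x|) ^ w.1 j / ((w.1 j).factorial : ℝ))
        (Real.exp (∑ j ∈ Finset.univ.erase ℓ, ‖t j‖ * |legMonomial j x|)) := by
      rw [← Complex.hasSum_ofReal]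
      push_cast
      push_cast at h
      exact h
    rw [Real.exp_add, ← mul_assoc]
    simp only [hnorm]
    exact h'.mul_left _
  have hsum : ∀ x, HasSum (fun w => F w x) (integrand t x) := fun x => by
    have h := hasSum_exp_sum_erase ℓ fun j => t j * (legMonomial j x : ℂ)
    rw [integrand_eq, ← Finset.add_sum_erase _ _ (Finset.mem_univ ℓ), Complex.exp_add, ← mul_assoc]
    simp only [hF]
    exact h.mul_left _
  have hcont : ∀ w, Continuous (F w) := fun w => by
    have h1 := fun j : Fin N => continuous_legMonomial j
    have h2 := continuous_gaussWeight
    simp only [F, taylorWeight]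
    fun_prop
  obtain ⟨K, hK⟩ := exists_exponent_le hE hℓ (c := -(t ℓ).re) (R := ‖t‖) (by linarith)
    (norm_nonneg _)
  have h := hasSum_integral_of_dominated_convergence (μ := volume) (F := F) (f := integrand t)
    (fun w x => ‖F w x‖) (fun w => (hcont w).aestronglyMeasurable)
    (fun w => Eventually.of_forall fun x => le_rfl)
    (Eventually.of_forall fun x => (hsumnorm x).summable) ?_ (Eventually.of_forall hsum)
  · refine h.of_eq fun w => ?_
    simp only [F, taylorCoeff]
    rw [integral_mul_const]
  · simp only [(hsumnorm _).tsum_eq]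
    refine (integrable_gaussWeight.mul_const (Real.exp K)).mono' ?_
      (Eventually.of_forall fun x => ?_)
    · refine Continuous.aestronglyMeasurable ?_
      have h1 := fun j : Fin N => continuous_legMonomial j
      have h2 := continuous_gaussWeight
      fun_prop
    · rw [Real.norm_of_nonneg (mul_nonneg (gaussWeight_nonneg x) (Real.exp_pos _).le)]
      exact mul_le_mul_of_nonneg_left (Real.exp_le_exp.2
        (hK _ _ (by simp) (norm_le_pi_norm t) x)) (gaussWeight_nonneg x)

/-- The mixed expansion of the partition function exists, is unique, and is the generating series
of pairing schemes. -/
theorem isMixedExpansion_partitionFunction_iff (hE : Even ((ℓ : ℕ) + 1))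
    (hℓ : ∀ j : Fin N, j ≤ ℓ) {Ω : Set ℂ} (hΩ : ∀ z ∈ Ω, z.re < 0) [(𝓝[Ω] (0 : ℂ)).NeBot]
    (B : MvPowerSeries (Fin N) ℂ) :
    IsMixedExpansion ℓ Ω partitionFunction B ↔
      B = MvPowerSeries.map (algebraMap ℚ ℂ) (pairingSeries N) := by
  classical
  constructor
  · rintro ⟨-, c, hc, hB⟩
    -- For fixed `z` both families are coefficients of the same everywhere convergent series. The
    -- monomials ignore the coordinate at `ℓ`, so an arbitrary `τ` may have it overwritten by `z`.
    have hcoeff : ∀ (w : {w : Fin N →₀ ℕ // w ℓ = 0}), ∀ z ∈ Ω, c w z = taylorCoeff ℓ w z := by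
      intro w z hz
      rw [← sub_eq_zero]
      refine eq_zero_of_hasSum_prod_pow
        (w := fun w : {w : Fin N →₀ ℕ // w ℓ = 0} => w.1) Subtype.val_injective
        (d := fun w => c w z - taylorCoeff ℓ w z) (fun τ => ?_) w
      let t := Function.update τ ℓ z
      have htℓ : t ℓ = z := Function.update_self _ _ _
      have h1 := (hc t (by rwa [htℓ])).sub (hasSum_taylorCoeff hE hℓ (t := t) (by
        rw [htℓ]; exact hΩ z hz))
      rw [sub_self] at h1
      refine h1.of_eq fun w => ?_
      have h2 : ∏ j, t j ^ w.1 j = ∏ j, τ j ^ w.1 j := by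
        refine Finset.prod_congr rfl fun j _ => ?_
        by_cases hj : j = ℓ
        · rw [hj, w.2, pow_zero, pow_zero]
        · rw [show t j = τ j from Function.update_of_ne hj _ _]
      rw [htℓ, h2, sub_mul]
    ext v
    -- Every multi-index is a part avoiding `ℓ` plus a multiple of the unit at `ℓ`, so the
    -- asymptotic expansions determine all coefficients.
    have hv : v.erase ℓ ℓ = 0 := Finsupp.erase_same
    have h1 := (hB ⟨v.erase ℓ, hv⟩).congr (hcoeff _)
    have h2 := h1.unique (fun h0 => by simpa using hΩ 0 h0)
      (isAsymptoticExpansion_taylorCoeff hE hΩ (v.erase ℓ) hv)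
    have h3 := congrArg (PowerSeries.coeff (v ℓ)) h2
    rw [PowerSeries.coeff_mk, PowerSeries.coeff_mk] at h3
    have h4 : v.erase ℓ + Finsupp.single ℓ (v ℓ) = v := Finsupp.erase_add_single ℓ v
    simpa only [h4] using h3
  · rintro rfl
    refine ⟨fun t ht => (differentiableAt_partitionFunction hE hℓ
      (hΩ _ ht)).differentiableWithinAt, fun w => taylorCoeff ℓ w.1,
      fun t ht => hasSum_taylorCoeff hE hℓ (hΩ _ ht),
      fun w => isAsymptoticExpansion_taylorCoeff hE hΩ w.1 w.2⟩

end Integrand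

/-! ### The sector -/

theorem re_neg_of_mem_sector {ε : ℝ} (hε : 0 < ε) {z : ℂ} (hz : z ∈ sector ε) : z.re < 0 := by
  obtain ⟨r, θ, hr, h1, h2, rfl⟩ := hz
  rw [Complex.re_ofReal_mul, Complex.exp_ofReal_mul_I_re]
  exact mul_neg_of_pos_of_neg hr
    (Real.cos_neg_of_pi_div_two_lt_of_lt (by linarith) (by linarith [Real.pi_pos]))

/-- The negative real axis lies in the sector and accumulates at `0`; without this, limits along the
sector would not be unique. -/
theorem neBot_nhdsWithin_sector {ε : ℝ} (hε : ε < Real.pi / 2) :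
    (𝓝[sector ε] (0 : ℂ)).NeBot := by
  rw [← mem_closure_iff_nhdsWithin_neBot]
  have h1 : Tendsto (fun r : ℝ => (r : ℂ) * Complex.exp ((Real.pi : ℂ) * Complex.I))
      (𝓝[>] 0) (𝓝 0) := by
    have : Continuous fun r : ℝ => (r : ℂ) * Complex.exp ((Real.pi : ℂ) * Complex.I) := by
      fun_prop
    have h := this.tendsto 0
    simp only [Complex.ofReal_zero, zero_mul] at h
    exact h.mono_left nhdsWithin_le_nhds
  refine mem_closure_of_tendsto h1 ?_
  filter_upwards [self_mem_nhdsWithin] with r hr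
  exact ⟨r, Real.pi, hr, by linarith, by linarith, rfl⟩

end FeynmanExpansion

end

theorem theorem1p6 (m : ℕ) (hm : 2 ≤ m) :
    ∃ A : MvPowerSeries (Fin (2 * m)) ℚ,
      (∀ ε : ℝ, 0 < ε → ε < Real.pi / 2 →
        (∀ t : Fin (2 * m) → ℂ, t ⟨2 * m - 1, by omega⟩ ∈ FeynmanExpansion.sector ε →
          MeasureTheory.Integrable (FeynmanExpansion.integrand t)) ∧
        ∀ B : MvPowerSeries (Fin (2 * m)) ℂ,
          FeynmanExpansion.IsMixedExpansion ⟨2 * m - 1, by omega⟩ (FeynmanExpansion.sector ε)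
            FeynmanExpansion.partitionFunction B ↔
          B = MvPowerSeries.map (algebraMap ℚ ℂ) A) ∧
      FeynmanExpansion.HasFormalSum
        (fun q : {q : FeynmanExpansion.GraphClass // q.rep.DegreesIn (2 * m)} =>
          FeynmanExpansion.graphTerm q.1.rep q.2) A ∧
      MvPowerSeries.constantCoeff A = 1 ∧
      FeynmanExpansion.HasFormalSum
        (fun q : {q : FeynmanExpansion.GraphClass //
            q.rep.DegreesIn (2 * m) ∧ q.rep.Connected} =>
          FeynmanExpansion.graphTerm q.1.rep q.2.1)
        (FeynmanExpansion.formalLog A) := by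
  have hE : Even ((((⟨2 * m - 1, by omega⟩ : Fin (2 * m)) : Fin (2 * m)) : ℕ) + 1) :=
    ⟨m, by simp only; omega⟩
  have hℓ : ∀ j : Fin (2 * m), j ≤ ⟨2 * m - 1, by omega⟩ := fun j => by
    rw [Fin.le_def]
    have := j.2
    simp only
    omega
  -- The witness is chosen before `ε`, which gives independence of `ε`; the equivalence for `B`
  -- contains both existence and uniqueness.
  refine ⟨FeynmanExpansion.pairingSeries (2 * m), fun ε hε hε' => ⟨fun t ht => ?_, fun B => ?_⟩,
    FeynmanExpansion.hasFormalSum_graphs _, FeynmanExpansion.constantCoeff_pairingSeries, ?_⟩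
  · exact FeynmanExpansion.integrable_integrand hE hℓ
      (FeynmanExpansion.re_neg_of_mem_sector hε ht)
  · have := FeynmanExpansion.neBot_nhdsWithin_sector hε'
    exact FeynmanExpansion.isMixedExpansion_partitionFunction_iff hE hℓ
      (fun z hz => FeynmanExpansion.re_neg_of_mem_sector hε hz) B
  · rw [FeynmanExpansion.formalLog_pairingSeries]
    exact FeynmanExpansion.hasFormalSum_connected_graphs _
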